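/- Notation. For $n\ge 1$ let $\mathcal K_1(\mathbb R^n)$ be the space of all $\varphi\in C^\infty(\mathbb R^n)$ (complex valued) with $\rho_k(\varphi)=\sup_{t\in\mathbb R^n,\,|\alpha|\le k}e^{k|t|}|\varphi^{(\alpha)}(t)|<\infty$ for all $k\in\mathbb N_0$, with the topology of the norms $\rho_k$. Let $\mathcal U(\mathbb C^n)$ be the space of all entire functions $\psi$ on $\mathbb C^n$ with $\sup_{z\in\Pi_k}(1+|z|^2)^{k/2}|\psi(z)|<\infty$ for all $k\in\mathbb N_0$, where $\Pi_k=\mathbb R^n+i[-k,k]^n$. Let $\mathcal K_1(\mathbb R)\widehat\otimes\mathcal U(\mathbb C^n)$ be the completion of $\mathcal K_1(\mathbb R)\otimes\mathcal U(\mathbb C^n)$, realised as a space of functions $\Phi(x,z)$, smooth in $x\in\mathbb R$ and entire in $z\in\mathbb C^n$, in the topology of the norms $$\rho^l_k(\Phi)=\sup_{(x,z)\in\mathbb R\times\Pi_k}e^{k|x|}(1+|z|^2)^{k/2}\left|\frac{\partial^l}{\partial x^l}\Phi(x,z)\right|,\qquad k,l\in\mathbb N_0 .$$ (That is, it is the closure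 of the span of the products $\varphi(x)\psi(z)$, $\varphi\in\mathcal K_1(\mathbb R)$, $\psi\in\mathcal U(\mathbb C^n)$, in the space of all such functions with finite norms $\rho^l_k$.) Let $\mathcal K_1'(\mathbb R^n)$ and $\mathcal K_1'(\mathbb R)\widehat\otimes\mathcal U'(\mathbb C^n)=(\mathcal K_1(\mathbb R)\widehat\otimes\mathcal U(\mathbb C^n))'$ be the dual spaces, with their strong topologies. For $u\in\mathbb S^{n-1}$ and $g\in\mathcal K_1(\mathbb R)$ put $$DS_{g,u}\varphi(x,z)=\int_{\mathbb R^n}\varphi(t)\,\overline{g(u\cdot t-x)}\,e^{-2\pi i t\cdot z}\,dt,\qquad \varphi\in\mathcal K_1(\mathbb R^n),\ (x,z)\in\mathbb R\times\mathbb C^n,$$ $$DS^*_{g,u}\Phi(t)=\int_{\mathbb R^n}\int_{\mathbb R}\Phi(x,\xi)\,g(u\cdot t-x)\,e^{2\pi i t\cdot\xi}\,dx\,d\xi,\qquad \Phi\in\mathcal K_1(\mathbb R)\widehat\otimes\mathcal U(\mathbb C^n),\ t\in\mathbb R^n .$$ Proposition. Let $g\in\mathcal K_1(\mathbb R)$ and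 $u\in\mathbb S^{n-1}$. (1) The integrals defining $DS^*_{\overline g,u}\Phi$ converge absolutely and $DS^*_{\overline g,u}\Phi\in\mathcal K_1(\mathbb R^n)$ for every $\Phi\in\mathcal K_1(\mathbb R)\widehat\otimes\mathcal U(\mathbb C^n)$, and the directional short-time Fourier transform, defined on distributions by $$\langle DS_{g,u}f,\Phi\rangle:=\langle f,DS^*_{\overline g,u}\Phi\rangle,\qquad f\in\mathcal K_1'(\mathbb R^n),\ \Phi\in\mathcal K_1(\mathbb R)\widehat\otimes\mathcal U(\mathbb C^n),$$ is a well defined continuous linear map $DS_{g,u}:\mathcal K_1'(\mathbb R^n)\to\mathcal K_1'(\mathbb R)\widehat\otimes\mathcal U'(\mathbb C^n)$. (2) The integrals defining $DS_{\overline g,u}\varphi$ converge absolutely and $DS_{\overline g,u}\varphi\in\mathcal K_1(\mathbb R)\widehat\otimes\mathcal U(\mathbb C^n)$ for every $\varphi\in\mathcal K_1(\mathbb R^n)$, and the directional synthesis operator, defined on distributions by $$\langle DS^*_{g,u}F,\varphi\rangle:=\langle F,DS_{\overline g,u}\varphi\rangle,\qquad F\in\mathcal K_1'(\mathbb R)\widehat\otimes\mathcal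 U'(\mathbb C^n),\ \varphi\in\mathcal K_1(\mathbb R^n),$$ is a well defined continuous linear map $DS^*_{g,u}:\mathcal K_1'(\mathbb R)\widehat\otimes\mathcal U'(\mathbb C^n)\to\mathcal K_1'(\mathbb R^n)$. -/

import Mathlib

open MeasureTheory TensorProduct
open scoped ContDiff ComplexConjugate

noncomputable section

/-- The supremum over an index of a pointwise bounded family of seminorms, given by its values. -/
def supSeminorm {M ι : Type*} [AddCommGroup M] [Module ℂ M] [Nonempty ι] (N : M → ι → ℝ)
    (hbdd : ∀ x, BddAbove (Set.range (N x))) (hadd : ∀ x y i, N (x + y) i ≤ N x i + N y i)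
    (hsmul : ∀ (c : ℂ) x i, N (c • x) i = ‖c‖ * N x i) : Seminorm ℂ M :=
  Seminorm.of (fun x => ⨆ i, N x i)
    (fun x y => ciSup_le fun i => (hadd x y i).trans
      (add_le_add (le_ciSup (hbdd x) i) (le_ciSup (hbdd y) i)))
    (fun c x => by
      simp only [hsmul]
      exact (Real.mul_iSup_of_nonneg (norm_nonneg c) _).symm)

theorem bddAbove_add {ι : Type*} {a b c : ι → ℝ} (h : ∀ i, c i ≤ a i + b i)
    (ha : BddAbove (Set.range a)) (hb : BddAbove (Set.range b)) : BddAbove (Set.range c) := by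
  obtain ⟨A, hA⟩ := ha
  obtain ⟨B, hB⟩ := hb
  refine ⟨A + B, ?_⟩
  rintro _ ⟨i, rfl⟩
  exact (h i).trans (add_le_add (hA ⟨i, rfl⟩) (hB ⟨i, rfl⟩))

theorem bddAbove_const_mul {ι : Type*} {a c : ι → ℝ} {r : ℝ} (hr : 0 ≤ r)
    (h : ∀ i, c i = r * a i) (ha : BddAbove (Set.range a)) : BddAbove (Set.range c) := by
  obtain ⟨A, hA⟩ := ha
  refine ⟨r * A, ?_⟩
  rintro _ ⟨i, rfl⟩
  simp only [h i]
  exact mul_le_mul_of_nonneg_left (hA ⟨i, rfl⟩) hr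

/-- Real Euclidean space `ℝⁿ`. -/
abbrev RSpace (n : ℕ) : Type := EuclideanSpace ℝ (Fin n)

/-- Complex Euclidean space `ℂⁿ`. -/
abbrev CSpace (n : ℕ) : Type := EuclideanSpace ℂ (Fin n)

/-- The inclusion `ℝⁿ ⊆ ℂⁿ`. -/
def realToComplex {n : ℕ} (ξ : RSpace n) : CSpace n := WithLp.toLp 2 fun j => (ξ j : ℂ)

/-- The bilinear product `t · z = ∑ t_j z_j` for `t ∈ ℝⁿ` and `z ∈ ℂⁿ`. -/
def bidot {n : ℕ} (t : RSpace n) (z : CSpace n) : ℂ := ∑ j, (t j : ℂ) * z j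

/-- The tube `Π_k = ℝⁿ + i [-k, k]ⁿ`. -/
def tube (n k : ℕ) : Set (CSpace n) := {z | ∀ j, |(z j).im| ≤ k}

theorem zero_mem_tube (n k : ℕ) : (0 : CSpace n) ∈ tube n k := by
  intro j
  simp

instance (n k : ℕ) : Nonempty (tube n k) := ⟨⟨0, zero_mem_tube n k⟩⟩

/-! ### The space `𝒦₁` of exponentially rapidly decreasing smooth functions -/

section K1

variable (E : Type*) [NormedAddCommGroup E] [NormedSpace ℝ E]

/-- The quantities `e^{k|t|} |D^m φ(t)|`, `t ∈ E`, `m ≤ k`. -/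
def k1Weight {E : Type*} [NormedAddCommGroup E] [NormedSpace ℝ E] (k : ℕ) (φ : E → ℂ)
    (p : E × Fin (k + 1)) : ℝ :=
  Real.exp (k * ‖p.1‖) * ‖iteratedFDeriv ℝ p.2 φ p.1‖

theorem k1Weight_add {E : Type*} [NormedAddCommGroup E] [NormedSpace ℝ E] (k : ℕ) {φ ψ : E → ℂ}
    (hφ : ContDiff ℝ ∞ φ) (hψ : ContDiff ℝ ∞ ψ) (p : E × Fin (k + 1)) :
    k1Weight k (φ + ψ) p ≤ k1Weight k φ p + k1Weight k ψ p := by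
  unfold k1Weight
  rw [iteratedFDeriv_add_apply (hφ.contDiffAt.of_le (by exact_mod_cast le_top))
    (hψ.contDiffAt.of_le (by exact_mod_cast le_top)), ← mul_add]
  exact mul_le_mul_of_nonneg_left (norm_add_le _ _) (Real.exp_pos _).le

theorem k1Weight_smul {E : Type*} [NormedAddCommGroup E] [NormedSpace ℝ E] (k : ℕ) (c : ℂ)
    {φ : E → ℂ} (hφ : ContDiff ℝ ∞ φ) (p : E × Fin (k + 1)) :
    k1Weight k (c • φ) p = ‖c‖ * k1Weight k φ p := by
  unfold k1Weight
  rw [iteratedFDeriv_const_smul_apply (hφ.contDiffAt.of_le (by exact_mod_cast le_top)), norm_smul]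
  ring

/-- The functions `φ ∈ C^∞(E)` with `ρ_k(φ) = sup_{t, m ≤ k} e^{k|t|} |D^m φ(t)| < ∞` for
all `k`, as a vector space. -/
def k1Submodule : Submodule ℂ (E → ℂ) where
  carrier := {φ | ContDiff ℝ ∞ φ ∧ ∀ k : ℕ, BddAbove (Set.range (k1Weight k φ))}
  add_mem' {φ ψ} hφ hψ := ⟨hφ.1.add hψ.1, fun k =>
    bddAbove_add (k1Weight_add k hφ.1 hψ.1) (hφ.2 k) (hψ.2 k)⟩
  zero_mem' := ⟨contDiff_const, fun k => ⟨0, by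
    rintro _ ⟨p, rfl⟩
    have h := k1Weight_smul k 0 (φ := (0 : E → ℂ)) contDiff_const p
    rw [smul_zero, norm_zero, zero_mul] at h
    exact h.le⟩⟩
  smul_mem' c φ hφ := ⟨contDiff_const.smul hφ.1, fun k =>
    bddAbove_const_mul (norm_nonneg c) (k1Weight_smul k c hφ.1) (hφ.2 k)⟩

/-- The space `𝒦₁(E)`; its topology is the one of the norms `ρ_k`. -/
def K1 : Type _ := ↥(k1Submodule E)

instance : AddCommGroup (K1 E) := inferInstanceAs (AddCommGroup ↥(k1Submodule E))

instance : Module ℂ (K1 E) := inferInstanceAs (Module ℂ ↥(k1Submodule E))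

instance : FunLike (K1 E) E ℂ where
  coe φ := φ.1
  coe_injective _ _ h := Subtype.ext h

/-- The norm `ρ_k(φ) = sup_{t, m ≤ k} e^{k|t|} |D^m φ(t)|`. -/
def K1.rho (k : ℕ) : Seminorm ℂ (K1 E) :=
  supSeminorm (fun φ p => k1Weight k φ p) (fun φ => φ.2.2 k)
    (fun φ ψ p => k1Weight_add k φ.2.1 ψ.2.1 p) (fun c φ p => k1Weight_smul k c φ.2.1 p)

instance : TopologicalSpace (K1 E) :=
  SeminormFamily.moduleFilterBasis (K1.rho E : SeminormFamily ℂ (K1 E) ℕ) |>.topology'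

theorem K1.withSeminorms : WithSeminorms (K1.rho E : SeminormFamily ℂ (K1 E) ℕ) := ⟨rfl⟩

instance : IsTopologicalAddGroup (K1 E) := (K1.withSeminorms E).topologicalAddGroup

instance : ContinuousSMul ℂ (K1 E) := (K1.withSeminorms E).continuousSMul

end K1

/-! ### The space `𝒰(ℂⁿ)` of entire functions rapidly decreasing on tubes -/

/-- The quantities `(1 + |z|²)^{k/2} |ψ(z)|`, `z ∈ Π_k`. -/
def uWeight {n : ℕ} (k : ℕ) (ψ : CSpace n → ℂ) (z : tube n k) : ℝ :=
  (1 + ‖(z : CSpace n)‖ ^ 2) ^ ((k : ℝ) / 2) * ‖ψ z‖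

/-- The space `𝒰(ℂⁿ)` of entire functions `ψ` with
`θ_k(ψ) = sup_{z ∈ Π_k} (1 + |z|²)^{k/2} |ψ(z)| < ∞` for all `k`. Only its vector space structure
is used, so `USpace n` carries no topology. -/
def uSubmodule (n : ℕ) : Submodule ℂ (CSpace n → ℂ) where
  carrier := {ψ | Differentiable ℂ ψ ∧ ∀ k : ℕ, BddAbove (Set.range (uWeight k ψ))}
  add_mem' {φ ψ} hφ hψ := ⟨hφ.1.add hψ.1, fun k => bddAbove_add (fun z => by
    unfold uWeight
    rw [← mul_add]
    exact mul_le_mul_of_nonneg_left (norm_add_le _ _) (by positivity)) (hφ.2 k) (hψ.2 k)⟩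
  zero_mem' := ⟨differentiable_const _, fun k => ⟨0, by
    rintro _ ⟨z, rfl⟩
    simp [uWeight]⟩⟩
  smul_mem' c φ hφ := ⟨hφ.1.const_smul c, fun k => bddAbove_const_mul (norm_nonneg c) (fun z => by
    unfold uWeight
    rw [Pi.smul_apply, norm_smul]
    ring) (hφ.2 k)⟩

/-- The space `𝒰(ℂⁿ)`. -/
def USpace (n : ℕ) : Type := ↥(uSubmodule n)

instance (n : ℕ) : AddCommGroup (USpace n) := inferInstanceAs (AddCommGroup ↥(uSubmodule n))

instance (n : ℕ) : Module ℂ (USpace n) := inferInstanceAs (Module ℂ ↥(uSubmodule n))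

instance (n : ℕ) : FunLike (USpace n) (CSpace n) ℂ where
  coe φ := φ.1
  coe_injective _ _ h := Subtype.ext h

/-! ### Functions `Φ(x, z)`, smooth in `x ∈ ℝ` and entire in `z ∈ ℂⁿ`, with the norms `ρ^l_k` -/

/-- The quantities `e^{k|x|} (1 + |z|²)^{k/2} |∂_x^l Φ(x, z)|`, `x ∈ ℝ`, `z ∈ Π_k`. -/
def kuWeight {n : ℕ} (k l : ℕ) (Φ : ℝ → CSpace n → ℂ) (p : ℝ × tube n k) : ℝ :=
  Real.exp (k * |p.1|) * (1 + ‖(p.2 : CSpace n)‖ ^ 2) ^ ((k : ℝ) / 2) *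
    ‖iteratedDeriv l (fun x => Φ x p.2) p.1‖

theorem kuWeight_add {n : ℕ} (k l : ℕ) {Φ Ψ : ℝ → CSpace n → ℂ}
    (hΦ : ∀ z, ContDiff ℝ ∞ fun x => Φ x z) (hΨ : ∀ z, ContDiff ℝ ∞ fun x => Ψ x z)
    (p : ℝ × tube n k) : kuWeight k l (Φ + Ψ) p ≤ kuWeight k l Φ p + kuWeight k l Ψ p := by
  unfold kuWeight
  have h : iteratedDeriv l (fun x => (Φ + Ψ) x p.2) p.1 =
      iteratedDeriv l (fun x => Φ x p.2) p.1 + iteratedDeriv l (fun x => Ψ x p.2) p.1 :=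
    iteratedDeriv_add ((hΦ _).contDiffAt.of_le (by exact_mod_cast le_top))
      ((hΨ _).contDiffAt.of_le (by exact_mod_cast le_top))
  rw [h, ← mul_add]
  exact mul_le_mul_of_nonneg_left (norm_add_le _ _) (by positivity)

theorem kuWeight_smul {n : ℕ} (k l : ℕ) (c : ℂ) {Φ : ℝ → CSpace n → ℂ}
    (hΦ : ∀ z, ContDiff ℝ ∞ fun x => Φ x z) (p : ℝ × tube n k) :
    kuWeight k l (c • Φ) p = ‖c‖ * kuWeight k l Φ p := by
  unfold kuWeight
  have h : iteratedDeriv l (fun x => (c • Φ) x p.2) p.1 =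
      c • iteratedDeriv l (fun x => Φ x p.2) p.1 :=
    iteratedDeriv_const_smul ((hΦ _).contDiffAt.of_le (by exact_mod_cast le_top)) c
  rw [h, norm_smul]
  ring

/-- The functions `Φ(x, z)`, smooth in `x` and entire in `z`, for which all the norms
`ρ^l_k(Φ) = sup_{x ∈ ℝ, z ∈ Π_k} e^{k|x|} (1 + |z|²)^{k/2} |∂_x^l Φ(x, z)|` are finite. -/
def kuSubmodule (n : ℕ) : Submodule ℂ (ℝ → CSpace n → ℂ) where
  carrier := {Φ | (∀ z, ContDiff ℝ ∞ fun x => Φ x z) ∧ (∀ x, Differentiable ℂ (Φ x)) ∧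
    ∀ k l : ℕ, BddAbove (Set.range (kuWeight k l Φ))}
  add_mem' {Φ Ψ} hΦ hΨ := ⟨fun z => (hΦ.1 z).add (hΨ.1 z), fun x => (hΦ.2.1 x).add (hΨ.2.1 x),
    fun k l => bddAbove_add (kuWeight_add k l hΦ.1 hΨ.1) (hΦ.2.2 k l) (hΨ.2.2 k l)⟩
  zero_mem' := ⟨fun _ => contDiff_const, fun _ => differentiable_const _, fun k l => ⟨0, by
    rintro _ ⟨p, rfl⟩
    have h := kuWeight_smul k l 0 (Φ := (0 : ℝ → CSpace n → ℂ)) (fun _ => contDiff_const) p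
    rw [smul_zero, norm_zero, zero_mul] at h
    exact h.le⟩⟩
  smul_mem' c Φ hΦ := ⟨fun z => (hΦ.1 z).const_smul c, fun x => (hΦ.2.1 x).const_smul c,
    fun k l => bddAbove_const_mul (norm_nonneg c) (kuWeight_smul k l c hΦ.1) (hΦ.2.2 k l)⟩

/-- The functions of two variables with finite norms `ρ^l_k`, in the topology of these norms. -/
def KUFun (n : ℕ) : Type := ↥(kuSubmodule n)

instance (n : ℕ) : AddCommGroup (KUFun n) := inferInstanceAs (AddCommGroup ↥(kuSubmodule n))

instance (n : ℕ) : Module ℂ (KUFun n) := inferInstanceAs (Module ℂ ↥(kuSubmodule n))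

instance (n : ℕ) : FunLike (KUFun n) ℝ (CSpace n → ℂ) where
  coe φ := φ.1
  coe_injective _ _ h := Subtype.ext h

/-- The norm `ρ^l_k`. -/
def KUFun.rho (n : ℕ) (kl : ℕ × ℕ) : Seminorm ℂ (KUFun n) :=
  supSeminorm (fun Φ p => kuWeight kl.1 kl.2 Φ p) (fun Φ => Φ.2.2.2 kl.1 kl.2)
    (fun Φ Ψ p => kuWeight_add kl.1 kl.2 Φ.2.1 Ψ.2.1 p)
    (fun c Φ p => kuWeight_smul kl.1 kl.2 c Φ.2.1 p)

instance (n : ℕ) : TopologicalSpace (KUFun n) :=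
  SeminormFamily.moduleFilterBasis (KUFun.rho n : SeminormFamily ℂ (KUFun n) (ℕ × ℕ)) |>.topology'

theorem KUFun.withSeminorms (n : ℕ) :
    WithSeminorms (KUFun.rho n : SeminormFamily ℂ (KUFun n) (ℕ × ℕ)) := ⟨rfl⟩

instance (n : ℕ) : IsTopologicalAddGroup (KUFun n) := (KUFun.withSeminorms n).topologicalAddGroup

instance (n : ℕ) : ContinuousSMul ℂ (KUFun n) := (KUFun.withSeminorms n).continuousSMul

/-! ### The completed tensor product `𝒦₁(ℝ) ⊗̂ 𝒰(ℂⁿ)` -/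

/-- The function `(φ ⊗ ψ)(x, z) = φ(x) ψ(z)`. -/
def pureTensor {n : ℕ} (φ : K1 ℝ) (ψ : USpace n) : KUFun n :=
  ⟨fun x z => φ x * ψ z, fun z => φ.2.1.mul contDiff_const,
    fun x => (differentiable_const _).mul ψ.2.1, fun k l => by
      obtain ⟨A, hA⟩ := φ.2.2 (max k l)
      obtain ⟨B, hB⟩ := ψ.2.2 k
      refine ⟨A * B, ?_⟩
      rintro _ ⟨⟨x, z⟩, rfl⟩
      have h1 : Real.exp (k * |x|) * ‖iteratedDeriv l φ x‖ ≤ A := by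
        refine le_trans ?_ (hA ⟨(x, ⟨l, Nat.lt_succ_of_le (le_max_right k l)⟩), rfl⟩)
        simp only [k1Weight, norm_iteratedFDeriv_eq_norm_iteratedDeriv, Real.norm_eq_abs]
        refine mul_le_mul_of_nonneg_right (Real.exp_le_exp.2 ?_) (norm_nonneg _)
        exact mul_le_mul_of_nonneg_right (by exact_mod_cast le_max_left k l) (abs_nonneg x)
      have h2 : uWeight k ψ z ≤ B := hB ⟨z, rfl⟩
      have h3 : iteratedDeriv l (fun x => φ x * ψ z) x = iteratedDeriv l φ x * ψ z := by
        have := iteratedDeriv_const_smul (n := l) (x := x) (f := fun x => φ x)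
          (φ.2.1.contDiffAt.of_le (by exact_mod_cast le_top)) (ψ z)
        rw [smul_eq_mul, mul_comm] at this
        rw [← this]
        exact congrArg (fun f => iteratedDeriv l f x) (funext fun y => mul_comm _ _)
      have h0 : 0 ≤ uWeight k ψ z := by unfold uWeight; positivity
      have hA0 : 0 ≤ A := le_trans (by positivity) h1
      refine le_trans (le_of_eq ?_) (mul_le_mul h1 h2 h0 hA0)
      simp only [kuWeight, uWeight]
      rw [h3, norm_mul]
      ring⟩

/-- The canonical map `𝒦₁(ℝ) ⊗ 𝒰(ℂⁿ) → {Φ(x, z)}`, `φ ⊗ ψ ↦ φ(x) ψ(z)`. -/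
def tensorMap (n : ℕ) : K1 ℝ ⊗[ℂ] USpace n →ₗ[ℂ] KUFun n :=
  TensorProduct.lift (LinearMap.mk₂ ℂ pureTensor
    (fun _ _ _ => Subtype.ext (funext fun _ => funext fun _ => add_mul _ _ _))
    (fun _ _ _ => Subtype.ext (funext fun _ => funext fun _ => mul_assoc _ _ _))
    (fun _ _ _ => Subtype.ext (funext fun _ => funext fun _ => mul_add _ _ _))
    (fun _ _ _ => Subtype.ext (funext fun _ => funext fun _ => mul_left_comm _ _ _)))

/-- The completed tensor product `𝒦₁(ℝ) ⊗̂ 𝒰(ℂⁿ)`, realised as a space of functions `Φ(x, z)`: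
the completion of `𝒦₁(ℝ) ⊗ 𝒰(ℂⁿ)` for the norms `ρ^l_k`, that is, its closure in the
complete space of all functions for which these norms are finite. -/
def KTensorU (n : ℕ) : Submodule ℂ (KUFun n) := (LinearMap.range (tensorMap n)).topologicalClosure

/-! ### The transforms of functions -/

/-- The integrand `f(t) conj(g(u · t - x)) e^{-2πi t · z}` of the DSTFT. -/
def dstftIntegrand {n : ℕ} (g : ℝ → ℂ) (u : RSpace n) (f : RSpace n → ℂ) (x : ℝ) (z : CSpace n)
    (t : RSpace n) : ℂ :=
  f t * conj (g (inner ℝ u t - x)) * Complex.exp (-2 * Real.pi * Complex.I * bidot t z)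

/-- The DSTFT `DS_{g,u} f(x, z) = ∫ f(t) conj(g(u · t - x)) e^{-2πi t · z} dt`. -/
def dstft {n : ℕ} (g : ℝ → ℂ) (u : RSpace n) (f : RSpace n → ℂ) (x : ℝ) (z : CSpace n) : ℂ :=
  ∫ t, dstftIntegrand g u f x z t

/-- The integrand `Φ(x, ξ) g(u · t - x) e^{2πi t · ξ}` of the directional synthesis operator. -/
def synthIntegrand {n : ℕ} (g : ℝ → ℂ) (u : RSpace n) (Φ : ℝ → CSpace n → ℂ) (t : RSpace n)
    (x : ℝ) (ξ : RSpace n) : ℂ :=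
  Φ x (realToComplex ξ) *
    (Complex.exp (2 * Real.pi * Complex.I * (inner ℝ t ξ : ℝ)) * g (inner ℝ u t - x))

/-- The directional synthesis operator
`DS*_{g,u} Φ(t) = ∫_{ℝⁿ} ∫_ℝ Φ(x, ξ) g(u · t - x) e^{2πi t · ξ} dx dξ`. -/
def synth {n : ℕ} (g : ℝ → ℂ) (u : RSpace n) (Φ : ℝ → CSpace n → ℂ) (t : RSpace n) : ℂ :=
  ∫ ξ : RSpace n, ∫ x : ℝ, synthIntegrand g u Φ t x ξ

/-! ### The dual spaces, with their strong topologies -/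

/-- The space `𝒦₁'(ℝⁿ)` of distributions of exponential type. -/
abbrev K1Dual (n : ℕ) : Type := StrongDual ℂ (K1 (RSpace n))

/-- The space `𝒦₁'(ℝ) ⊗̂ 𝒰'(ℂⁿ) = (𝒦₁(ℝ) ⊗̂ 𝒰(ℂⁿ))'`. -/
abbrev KTensorUDual (n : ℕ) : Type := StrongDual ℂ (KTensorU n)

end

/-!
Both operators on distributions are transposes. If `S = DS*_{ḡ,u}` is a continuous linear map from
`𝒦₁(ℝ) ⊗̂ 𝒰(ℂⁿ)` to `𝒦₁(ℝⁿ)` and `V = DS_{ḡ,u}` is one in the other direction, then `f ↦ f ∘ S` and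
`F ↦ F ∘ V` are continuous between the strong duals. The work lies in the continuity of `S` and `V`
and in the values of `V`, which have to lie in the closure of the algebraic tensor product.

*The closure.* The algebraic tensor product is dense in the space of all `Φ(x, z)` with finite norms
`ρ^l_k` (`kTensorU_eq_top`). Replace `Φ` by a step function in `x` with finitely many values
`Φ(j / N, ·)` and convolve in `x` with a smooth bump function `η`. The result is a finite sum of
products, and the weights in `z` do not interfere, because each `Φ(j / N, ·)` is controlled by the
norms of `Φ` (`norm_iteratedDeriv_sub_convolution_stepInterp_le`, `KUFun.rho_sub_approx_le`).

*The synthesis operator.* Exponential decay of `SΦ(t)` comes from shifting the domain of integration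
from `ℝⁿ` to `ℝⁿ + iη`, with `η` a multiple of `t` (`integral_add_smul_realToComplex`,
`exp_mul_norm_synth_le`). A derivative in `t` replaces `(g, Φ)` by `(g', Φ)` or `(g, z_j Φ)`
(`hasFDerivAt_synth`), so the decay passes to derivatives of every order.

*The transform.* `Vφ` decays exponentially in `x`, uniformly for `z` in a tube, because `φ` absorbs
the growth of `e^{-2πi t · z}` (`exp_mul_norm_dstft_le`). A derivative in `x` replaces `g` by `-g'`
(`hasDerivAt_dstft`), and integration by parts trades a factor `z_j` for a derivative of `φ` or `g`
(`coord_mul_dstft`), which yields rapid decrease in `z`.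
-/

noncomputable section

/-! ### Maps into `𝒦₁` and into the space of functions of two variables -/

theorem Real.one_add_pow_le_exp_mul (m : ℕ) {s : ℝ} (hs : 0 ≤ s) :
    (1 + s) ^ m ≤ Real.exp (m * s) := by
  rw [Real.exp_nat_mul]
  gcongr
  linarith [Real.add_one_le_exp s]

namespace K1

section

variable {E : Type*} [NormedAddCommGroup E] [NormedSpace ℝ E]

theorem contDiff (φ : K1 E) : ContDiff ℝ ∞ φ := φ.2.1

theorem differentiable (φ : K1 E) : Differentiable ℝ φ := φ.contDiff.differentiable (by simp)

theorem continuous (φ : K1 E) : Continuous φ := φ.contDiff.continuous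

theorem exp_mul_norm_iteratedFDeriv_le (φ : K1 E) {k m : ℕ} (h : m ≤ k) (t : E) :
    Real.exp (k * ‖t‖) * ‖iteratedFDeriv ℝ m φ t‖ ≤ K1.rho E k φ :=
  le_ciSup (φ.2.2 k) (t, ⟨m, Nat.lt_succ_of_le h⟩)

theorem exp_mul_norm_le (φ : K1 E) (k : ℕ) (t : E) :
    Real.exp (k * ‖t‖) * ‖φ t‖ ≤ K1.rho E k φ := by
  have := φ.exp_mul_norm_iteratedFDeriv_le (Nat.zero_le k) t
  rwa [norm_iteratedFDeriv_zero] at this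

theorem norm_le (φ : K1 E) (k : ℕ) (t : E) :
    ‖φ t‖ ≤ K1.rho E k φ * Real.exp (-(k * ‖t‖)) := by
  rw [Real.exp_neg, ← div_eq_mul_inv, le_div_iff₀' (Real.exp_pos _)]
  exact φ.exp_mul_norm_le k t

theorem norm_le_rho (φ : K1 E) (k : ℕ) (t : E) : ‖φ t‖ ≤ K1.rho E k φ := by
  refine (φ.norm_le k t).trans (mul_le_of_le_one_right (apply_nonneg _ _) ?_)
  rw [Real.exp_le_one_iff]
  have := norm_nonneg t
  simp only [Left.neg_nonpos_iff]
  positivity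

theorem rho_le {φ : K1 E} {k : ℕ} {C : ℝ}
    (h : ∀ t, ∀ m ≤ k, Real.exp (k * ‖t‖) * ‖iteratedFDeriv ℝ m φ t‖ ≤ C) :
    K1.rho E k φ ≤ C :=
  ciSup_le fun p => h p.1 p.2 (Nat.le_of_lt_succ p.2.2)

variable {M : Type*} [AddCommGroup M] [Module ℂ M] [TopologicalSpace M]

/-- A linear map into functions whose weighted derivatives are all dominated by continuous
seminorms, as a linear map into `𝒦₁`. -/
def mkLinearMap (T : M →ₗ[ℂ] E → ℂ) (hT : ∀ Φ, ContDiff ℝ ∞ (T Φ))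
    (hb : ∀ k m : ℕ, ∃ p : Seminorm ℂ M, Continuous p ∧
      ∀ Φ t, Real.exp (k * ‖t‖) * ‖iteratedFDeriv ℝ m (T Φ) t‖ ≤ p Φ) : M →ₗ[ℂ] K1 E where
  toFun Φ := ⟨T Φ, hT Φ, fun k => by
    choose p hp using hb k
    refine ⟨∑ m ∈ Finset.range (k + 1), p m Φ, ?_⟩
    rintro _ ⟨⟨t, m⟩, rfl⟩
    exact ((hp m).2 Φ t).trans (Finset.single_le_sum (f := fun m => p m Φ)
      (fun i _ => apply_nonneg _ _) (Finset.mem_range.2 m.2))⟩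
  map_add' Φ Ψ := Subtype.ext (T.map_add Φ Ψ)
  map_smul' c Φ := Subtype.ext (T.map_smul c Φ)

variable [IsTopologicalAddGroup M]

/-- A linear map into functions whose weighted derivatives are all dominated by continuous
seminorms, as a continuous linear map into `𝒦₁`. -/
def mkCLM (T : M →ₗ[ℂ] E → ℂ) (hT : ∀ Φ, ContDiff ℝ ∞ (T Φ))
    (hb : ∀ k m : ℕ, ∃ p : Seminorm ℂ M, Continuous p ∧
      ∀ Φ t, Real.exp (k * ‖t‖) * ‖iteratedFDeriv ℝ m (T Φ) t‖ ≤ p Φ) : M →L[ℂ] K1 E where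
  toLinearMap := mkLinearMap T hT hb
  cont := by
    refine WithSeminorms.continuous_of_continuous_comp (K1.withSeminorms E)
      (mkLinearMap T hT hb) fun k => ?_
    choose p hp using hb k
    have hsum : ⇑(∑ m ∈ Finset.range (k + 1), p m) =
        fun Φ => ∑ m ∈ Finset.range (k + 1), p m Φ := funext fun Φ => by
      rw [← FunLike.coeAddMonoidHom_apply, map_sum, Finset.sum_apply]
      rfl
    refine Seminorm.continuous_of_le (q := ∑ m ∈ Finset.range (k + 1), p m) ?_ fun Φ => ?_
    · rw [hsum]
      exact continuous_finsetSum _ fun m _ => (hp m).1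
    · refine rho_le fun t m hm => ((hp m).2 Φ t).trans ?_
      rw [hsum]
      exact Finset.single_le_sum (f := fun m => p m Φ)
        (fun i _ => apply_nonneg _ _) (Finset.mem_range.2 (Nat.lt_succ_of_le hm))

/-- The directional derivative `φ ↦ ∂_v φ` on `𝒦₁`. -/
def lineDeriv (v : E) : K1 E →L[ℂ] K1 E :=
  mkCLM
    { toFun := fun φ t => fderiv ℝ φ t v
      map_add' := fun φ ψ => funext fun t => by
        have : fderiv ℝ (⇑φ + ⇑ψ) t = fderiv ℝ φ t + fderiv ℝ ψ t :=
          fderiv_add (φ.differentiable t) (ψ.differentiable t)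
        exact congrArg (fun L => L v) this
      map_smul' := fun c φ => funext fun t => by
        have : fderiv ℝ (c • ⇑φ) t = c • fderiv ℝ φ t := fderiv_const_smul (φ.differentiable t) c
        exact congrArg (fun L => L v) this }
    (fun φ => (φ.contDiff.fderiv_right (m := ∞) (by simp)).clm_apply contDiff_const)
    (fun k m => by
      refine ⟨‖v‖₊ • K1.rho E (k + m + 1), ?_, fun φ t => ?_⟩
      · exact ((K1.withSeminorms E).continuous_seminorm _).const_smul ‖v‖₊
      · have h1 : ‖iteratedFDeriv ℝ m (fun t => fderiv ℝ φ t v) t‖ ≤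
            ‖v‖ * ‖iteratedFDeriv ℝ (m + 1) φ t‖ := by
          rw [← norm_iteratedFDeriv_fderiv]
          exact norm_iteratedFDeriv_clm_apply_const
            (φ.contDiff.fderiv_right (m := ∞) (by simp)).contDiffAt (by exact_mod_cast le_top)
        have h2 := φ.exp_mul_norm_iteratedFDeriv_le (k := k + m + 1) (m := m + 1) (by omega) t
        have h3 : Real.exp (k * ‖t‖) ≤ Real.exp ((k + m + 1 : ℕ) * ‖t‖) := by
          gcongr
          omega
        calc Real.exp (k * ‖t‖) * ‖iteratedFDeriv ℝ m (fun t => fderiv ℝ φ t v) t‖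
            ≤ Real.exp ((k + m + 1 : ℕ) * ‖t‖) * (‖v‖ * ‖iteratedFDeriv ℝ (m + 1) φ t‖) := by
              gcongr
          _ = ‖v‖ * (Real.exp ((k + m + 1 : ℕ) * ‖t‖) * ‖iteratedFDeriv ℝ (m + 1) φ t‖) := by ring
          _ ≤ ‖v‖ * K1.rho E (k + m + 1) φ := by gcongr)

theorem lineDeriv_apply (v : E) (φ : K1 E) (t : E) : lineDeriv v φ t = fderiv ℝ φ t v := rfl

/-- A smooth function of compact support belongs to `𝒦₁`. -/
def ofHasCompactSupport (f : E → ℂ) (hf : ContDiff ℝ ∞ f) (hc : HasCompactSupport f) : K1 E :=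
  ⟨f, hf, fun k => by
    have h : ∀ m : ℕ, ∃ C, ∀ t, ‖Real.exp (k * ‖t‖) • iteratedFDeriv ℝ m f t‖ ≤ C := fun m =>
      ((hc.iteratedFDeriv m).smul_left
        (f := fun t => Real.exp (k * ‖t‖))).exists_bound_of_continuous
        ((by fun_prop : Continuous fun t : E => Real.exp (k * ‖t‖)).smul
          (hf.continuous_iteratedFDeriv (by exact_mod_cast le_top)))
    choose C hC using h
    refine ⟨∑ m ∈ Finset.range (k + 1), C m, ?_⟩
    rintro _ ⟨⟨t, m⟩, rfl⟩
    have := hC m t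
    rw [norm_smul, Real.norm_of_nonneg (Real.exp_pos _).le] at this
    exact this.trans (Finset.single_le_sum (f := C)
      (fun i _ => (norm_nonneg _).trans (hC i t)) (Finset.mem_range.2 m.2))⟩

/-- Complex conjugation on `𝒦₁`. -/
def conjugate (φ : K1 E) : K1 E :=
  ⟨fun t => conj (φ t), Complex.conjLIE.contDiff.comp φ.contDiff, fun k => by
    have : k1Weight k (fun t => conj (φ t)) = k1Weight k φ := funext fun p => by
      unfold k1Weight
      congr 1
      exact LinearIsometryEquiv.norm_iteratedFDeriv_comp_left Complex.conjLIE φ p.1 p.2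
    rw [this]
    exact φ.2.2 k⟩

end

/-- The derivative on `𝒦₁(ℝ)`. -/
def deriv : K1 ℝ →L[ℂ] K1 ℝ := lineDeriv 1

theorem hasDerivAt (h : K1 ℝ) (s : ℝ) : HasDerivAt h (deriv h s) s :=
  (h.differentiable s).hasDerivAt

end K1

namespace KUFun

variable {n : ℕ}

theorem contDiff (Φ : KUFun n) (z : CSpace n) : ContDiff ℝ ∞ fun x => Φ x z := Φ.2.1 z

theorem differentiable (Φ : KUFun n) (x : ℝ) : Differentiable ℂ (Φ x) := Φ.2.2.1 x

theorem weight_le_rho (Φ : KUFun n) (k l : ℕ) (x : ℝ) {z : CSpace n} (hz : z ∈ tube n k) :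
    Real.exp (k * |x|) * (1 + ‖z‖ ^ 2) ^ ((k : ℝ) / 2) * ‖iteratedDeriv l (fun x => Φ x z) x‖ ≤
      KUFun.rho n (k, l) Φ :=
  le_ciSup (Φ.2.2.2 k l) (x, ⟨z, hz⟩)

theorem rho_le {Φ : KUFun n} {k l : ℕ} {C : ℝ}
    (h : ∀ x, ∀ z ∈ tube n k, Real.exp (k * |x|) * (1 + ‖z‖ ^ 2) ^ ((k : ℝ) / 2) *
      ‖iteratedDeriv l (fun x => Φ x z) x‖ ≤ C) : KUFun.rho n (k, l) Φ ≤ C :=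
  ciSup_le fun p => h p.1 p.2.1 p.2.2

theorem rpow_weight_le (k : ℕ) {r : ℝ} (hr : 0 ≤ r) :
    (1 + r ^ 2) ^ ((k : ℝ) / 2) ≤ (1 + r) ^ k := by
  calc (1 + r ^ 2) ^ ((k : ℝ) / 2) ≤ ((1 + r) ^ 2) ^ ((k : ℝ) / 2) := by
        gcongr
        nlinarith
    _ = (1 + r) ^ k := by
        rw [← Real.rpow_natCast (1 + r) 2, ← Real.rpow_mul (by positivity), ← Real.rpow_natCast]
        congr 1
        push_cast
        ring

theorem pow_le_rpow_weight (k : ℕ) {r : ℝ} (hr : 0 ≤ r) :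
    (1 + r) ^ k ≤ 2 ^ k * (1 + r ^ 2) ^ ((k : ℝ) / 2) := by
  calc (1 + r) ^ k = ((1 + r) ^ 2) ^ ((k : ℝ) / 2) := by
        rw [← Real.rpow_natCast (1 + r) 2, ← Real.rpow_mul (by positivity), ← Real.rpow_natCast]
        congr 1
        push_cast
        ring
    _ ≤ (2 ^ 2 * (1 + r ^ 2)) ^ ((k : ℝ) / 2) := by
        gcongr
        nlinarith [sq_nonneg (1 - r), sq_nonneg r]
    _ = 2 ^ k * (1 + r ^ 2) ^ ((k : ℝ) / 2) := by
        rw [Real.mul_rpow (by positivity) (by positivity), ← Real.rpow_natCast (2 : ℝ) 2,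
          ← Real.rpow_mul (by positivity), ← Real.rpow_natCast 2 k]
        congr 2
        push_cast
        ring

theorem norm_le (Φ : KUFun n) (k : ℕ) (x : ℝ) {z : CSpace n} (hz : z ∈ tube n k) :
    ‖Φ x z‖ ≤ 2 ^ k * KUFun.rho n (k, 0) Φ * Real.exp (-(k * |x|)) * ((1 + ‖z‖) ^ k)⁻¹ := by
  have h := Φ.weight_le_rho k 0 x hz
  rw [iteratedDeriv_zero] at h
  have h2 := pow_le_rpow_weight k (norm_nonneg z)
  rw [← div_eq_mul_inv, le_div_iff₀ (by positivity), Real.exp_neg, ← div_eq_mul_inv,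
    le_div_iff₀ (by positivity)]
  calc ‖Φ x z‖ * (1 + ‖z‖) ^ k * Real.exp (k * |x|)
      ≤ ‖Φ x z‖ * (2 ^ k * (1 + ‖z‖ ^ 2) ^ ((k : ℝ) / 2)) * Real.exp (k * |x|) := by gcongr
    _ = 2 ^ k * (Real.exp (k * |x|) * (1 + ‖z‖ ^ 2) ^ ((k : ℝ) / 2) * ‖Φ x z‖) := by ring
    _ ≤ _ := by gcongr

variable {M : Type*} [AddCommGroup M] [Module ℂ M] [TopologicalSpace M]

/-- A linear map into functions of two variables whose weighted derivatives are all dominated by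
continuous seminorms, as a linear map into the space with the norms `ρ^l_k`. -/
def mkLinearMap (T : M →ₗ[ℂ] ℝ → CSpace n → ℂ) (hT : ∀ Φ z, ContDiff ℝ ∞ fun x => T Φ x z)
    (hT' : ∀ Φ x, Differentiable ℂ (T Φ x))
    (hb : ∀ k l : ℕ, ∃ p : Seminorm ℂ M, Continuous p ∧ ∀ Φ x, ∀ z ∈ tube n k,
      Real.exp (k * |x|) * (1 + ‖z‖ ^ 2) ^ ((k : ℝ) / 2) *
        ‖iteratedDeriv l (fun x => T Φ x z) x‖ ≤ p Φ) : M →ₗ[ℂ] KUFun n where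
  toFun Φ := ⟨T Φ, hT Φ, hT' Φ, fun k l => by
    obtain ⟨p, -, hp⟩ := hb k l
    refine ⟨p Φ, ?_⟩
    rintro _ ⟨⟨x, z⟩, rfl⟩
    exact hp Φ x z z.2⟩
  map_add' Φ Ψ := Subtype.ext (T.map_add Φ Ψ)
  map_smul' c Φ := Subtype.ext (T.map_smul c Φ)

variable [IsTopologicalAddGroup M]

/-- A linear map into functions of two variables whose weighted derivatives are all dominated by
continuous seminorms, as a continuous linear map into the space with the norms `ρ^l_k`. -/
def mkCLM (T : M →ₗ[ℂ] ℝ → CSpace n → ℂ) (hT : ∀ Φ z, ContDiff ℝ ∞ fun x => T Φ x z)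
    (hT' : ∀ Φ x, Differentiable ℂ (T Φ x))
    (hb : ∀ k l : ℕ, ∃ p : Seminorm ℂ M, Continuous p ∧ ∀ Φ x, ∀ z ∈ tube n k,
      Real.exp (k * |x|) * (1 + ‖z‖ ^ 2) ^ ((k : ℝ) / 2) *
        ‖iteratedDeriv l (fun x => T Φ x z) x‖ ≤ p Φ) : M →L[ℂ] KUFun n where
  toLinearMap := mkLinearMap T hT hT' hb
  cont := by
    refine WithSeminorms.continuous_of_continuous_comp (KUFun.withSeminorms n)
      (mkLinearMap T hT hT' hb) fun kl => ?_
    obtain ⟨p, hc, hp⟩ := hb kl.1 kl.2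
    exact Seminorm.continuous_of_le hc fun Φ => rho_le (hp Φ)

theorem norm_coord_le (z : CSpace n) (j : Fin n) : ‖z j‖ ≤ ‖z‖ := PiLp.norm_apply_le z j

/-- Multiplication by the coordinate `z_j`. -/
def mulCoord (j : Fin n) : KUFun n →L[ℂ] KUFun n :=
  mkCLM
    { toFun := fun Φ x z => z j * Φ x z
      map_add' := fun Φ Ψ => funext fun x => funext fun z => mul_add (z j) (Φ x z) (Ψ x z)
      map_smul' := fun c Φ => funext fun x => funext fun z => mul_left_comm (z j) c (Φ x z) }
    (fun Φ z => contDiff_const.mul (Φ.contDiff z))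
    (fun Φ x => (EuclideanSpace.proj (𝕜 := ℂ) j).differentiable.mul (Φ.differentiable x))
    (fun k l => by
      refine ⟨KUFun.rho n (k + 1, l), (KUFun.withSeminorms n).continuous_seminorm _,
        fun Φ x z hz => ?_⟩
      have h1 : iteratedDeriv l (fun x => z j * Φ x z) x =
          z j * iteratedDeriv l (fun x => Φ x z) x :=
        iteratedDeriv_const_mul _ ((Φ.contDiff z).contDiffAt.of_le (by exact_mod_cast le_top))
      have hz' : z ∈ tube n (k + 1) := fun i => (hz i).trans (by push_cast; linarith)
      have h2 : ‖z j‖ * (1 + ‖z‖ ^ 2) ^ ((k : ℝ) / 2) ≤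
          (1 + ‖z‖ ^ 2) ^ (((k + 1 : ℕ) : ℝ) / 2) := by
        have : ‖z j‖ ≤ (1 + ‖z‖ ^ 2) ^ ((1 : ℝ) / 2) := by
          rw [← Real.sqrt_eq_rpow]
          refine (norm_coord_le z j).trans (Real.le_sqrt_of_sq_le (by linarith))
        calc ‖z j‖ * (1 + ‖z‖ ^ 2) ^ ((k : ℝ) / 2)
            ≤ (1 + ‖z‖ ^ 2) ^ ((1 : ℝ) / 2) * (1 + ‖z‖ ^ 2) ^ ((k : ℝ) / 2) := by gcongr
          _ = _ := by
            rw [← Real.rpow_add (by positivity)]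
            congr 1
            push_cast
            ring
      have h3 := Φ.weight_le_rho (k + 1) l x hz'
      have h4 : Real.exp (k * |x|) ≤ Real.exp ((k + 1 : ℕ) * |x|) := by
        gcongr
        omega
      calc Real.exp (k * |x|) * (1 + ‖z‖ ^ 2) ^ ((k : ℝ) / 2) *
            ‖iteratedDeriv l (fun x => z j * Φ x z) x‖
          = Real.exp (k * |x|) * (‖z j‖ * (1 + ‖z‖ ^ 2) ^ ((k : ℝ) / 2)) *
            ‖iteratedDeriv l (fun x => Φ x z) x‖ := by rw [h1, norm_mul]; ring
        _ ≤ Real.exp ((k + 1 : ℕ) * |x|) * (1 + ‖z‖ ^ 2) ^ (((k + 1 : ℕ) : ℝ) / 2) *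
            ‖iteratedDeriv l (fun x => Φ x z) x‖ := by gcongr
        _ ≤ _ := h3)

theorem mulCoord_apply (j : Fin n) (Φ : KUFun n) (x : ℝ) (z : CSpace n) :
    mulCoord j Φ x z = z j * Φ x z := rfl

end KUFun

/-! ### Density of the algebraic tensor product -/

theorem ContDiff.iteratedDeriv {f : ℝ → ℂ} (hf : ContDiff ℝ ∞ f) (l : ℕ) :
    ContDiff ℝ ∞ (iteratedDeriv l f) := by
  induction l with
  | zero => simpa
  | succ l ih =>
    rw [iteratedDeriv_succ]
    exact (contDiff_infty_iff_deriv.1 ih).2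

theorem tsupport_iteratedDeriv_subset (f : ℝ → ℝ) (l : ℕ) :
    tsupport (iteratedDeriv l f) ⊆ tsupport f := by
  induction l with
  | zero => simp
  | succ l ih =>
    rw [iteratedDeriv_succ]
    exact tsupport_deriv_subset.trans ih

theorem HasCompactSupport.iteratedDeriv {f : ℝ → ℝ} (hf : HasCompactSupport f) (l : ℕ) :
    HasCompactSupport (iteratedDeriv l f) :=
  hf.of_isClosed_subset isClosed_closure (tsupport_iteratedDeriv_subset f l)

open Convolution in
theorem iteratedDeriv_convolution_left {η : ℝ → ℝ} (hη : ContDiff ℝ ∞ η)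
    (hc : HasCompactSupport η) {f : ℝ → ℂ} (hf : LocallyIntegrable f) (l : ℕ) :
    iteratedDeriv l (η ⋆[ContinuousLinearMap.lsmul ℝ ℝ] f) =
      (iteratedDeriv l η ⋆[ContinuousLinearMap.lsmul ℝ ℝ] f) := by
  induction l generalizing η with
  | zero => simp
  | succ l ih =>
    rw [iteratedDeriv_succ', iteratedDeriv_succ', ← ih (contDiff_infty_iff_deriv.1 hη).2 hc.deriv]
    congr 1
    exact funext fun x => (hc.hasDerivAt_convolution_left (ContinuousLinearMap.lsmul ℝ ℝ)
      (hη.of_le (by exact_mod_cast le_top)) hf x).deriv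

open Convolution in
/-- Integration by parts moves the derivative from one factor of a convolution to the other. -/
theorem deriv_convolution_eq_convolution_deriv {η : ℝ → ℝ} (hη : ContDiff ℝ ∞ η)
    (hc : HasCompactSupport η) {f : ℝ → ℂ} (hf : ContDiff ℝ ∞ f) :
    (deriv η ⋆[ContinuousLinearMap.lsmul ℝ ℝ] f) =
      (η ⋆[ContinuousLinearMap.lsmul ℝ ℝ] deriv f) := by
  funext x
  have hd : ∀ t, HasDerivAt (fun t => f (x - t)) (-deriv f (x - t)) t := fun t => by
    have := HasDerivAt.scomp t (h := fun t => x - t) (g₁ := f)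
      ((hf.differentiable (by simp)) _).hasDerivAt ((hasDerivAt_id t).const_sub x)
    rwa [neg_smul, one_smul] at this
  have hf' : Continuous (deriv f) := (contDiff_infty_iff_deriv.1 hf).2.continuous
  have hη' : Continuous (deriv η) := (contDiff_infty_iff_deriv.1 hη).2.continuous
  have hfc : Continuous f := hf.continuous
  have hηc : Continuous η := hη.continuous
  have hfd : ∀ t, fderiv ℝ (fun t => f (x - t)) t 1 = -deriv f (x - t) := fun t => (hd t).deriv
  have h := integral_smul_fderiv_eq_neg_fderiv_smul_of_integrable (μ := (volume : Measure ℝ))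
    (f := η) (g := fun t => f (x - t)) (v := 1) ?_ ?_ ?_
    (fun t _ => hη.differentiable (by simp) t) (fun t _ => (hd t).differentiableAt)
  · simp only [hfd, fderiv_apply_one_eq_deriv, smul_neg, integral_neg, neg_inj] at h
    simpa [convolution] using h.symm
  · simp only [fderiv_apply_one_eq_deriv]
    exact (by fun_prop : Continuous fun t => deriv η t • f (x - t)).integrable_of_hasCompactSupport
      hc.deriv.smul_right
  · simp only [hfd]
    exact (by fun_prop : Continuous fun t => η t • -deriv f (x - t)).integrable_of_hasCompactSupport
      hc.smul_right
  · exact (by fun_prop : Continuous fun t => η t • f (x - t)).integrable_of_hasCompactSupport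
      hc.smul_right

open Convolution in
theorem iteratedDeriv_convolution_eq {η : ℝ → ℝ} (hη : ContDiff ℝ ∞ η)
    (hc : HasCompactSupport η) {f : ℝ → ℂ} (hf : ContDiff ℝ ∞ f) (l : ℕ) :
    (iteratedDeriv l η ⋆[ContinuousLinearMap.lsmul ℝ ℝ] f) =
      (η ⋆[ContinuousLinearMap.lsmul ℝ ℝ] iteratedDeriv l f) := by
  induction l generalizing η f with
  | zero => simp
  | succ l ih =>
    rw [iteratedDeriv_succ', ih (contDiff_infty_iff_deriv.1 hη).2 hc.deriv hf,
      deriv_convolution_eq_convolution_deriv hη hc (hf.iteratedDeriv l), iteratedDeriv_succ]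

theorem exp_neg_mul_abs_le (k : ℕ) {x y : ℝ} (h : |y - x| ≤ 1) :
    Real.exp (-(k * |y|)) ≤ Real.exp k * Real.exp (-(k * |x|)) := by
  rw [← Real.exp_add]
  gcongr
  have h1 : |x| ≤ |y| + 1 := by
    have := abs_sub_abs_le_abs_sub x y
    rw [abs_sub_comm] at this
    linarith
  have := mul_le_mul_of_nonneg_left h1 (Nat.cast_nonneg (α := ℝ) k)
  linarith

theorem norm_sub_le_of_norm_deriv_le_exp {f : ℝ → ℂ} (hf : Differentiable ℝ f) {k : ℕ} {M r : ℝ}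
    (hM : 0 ≤ M) (hf' : ∀ y, ‖deriv f y‖ ≤ M * Real.exp (-(k * |y|))) (hr : r ≤ 1) {x y : ℝ}
    (hxy : |y - x| ≤ r) : ‖f y - f x‖ ≤ M * Real.exp k * Real.exp (-(k * |x|)) * r := by
  have hr0 : 0 ≤ r := (abs_nonneg _).trans hxy
  have h := Convex.norm_image_sub_le_of_norm_deriv_le (f := f) (s := Metric.closedBall x r)
    (C := M * Real.exp k * Real.exp (-(k * |x|))) (x := x) (y := y)
    (fun t _ => hf t) (fun t ht => ?_) (convex_closedBall x r) (Metric.mem_closedBall_self hr0)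
    (by simpa [Real.dist_eq] using hxy)
  · refine h.trans ?_
    rw [Real.norm_eq_abs]
    gcongr
  · refine (hf' t).trans ?_
    rw [mul_assoc]
    gcongr
    rw [Metric.mem_closedBall, Real.dist_eq] at ht
    exact exp_neg_mul_abs_le k (ht.trans hr)

/-- The interval `[j / N, (j + 1) / N)`. -/
def gridCell (N : ℕ) (j : ℤ) : Set ℝ := {y | ⌊N * y⌋ = j}

theorem measurableSet_gridCell (N : ℕ) (j : ℤ) : MeasurableSet (gridCell N j) :=
  (by fun_prop : Measurable fun y : ℝ => ⌊(N : ℝ) * y⌋) (measurableSet_singleton j)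

/-- The step function interpolating `f` at the left end points of the intervals
`[j / N, (j + 1) / N)`, `|j| ≤ N²`, which cover `[-N, N]`. -/
def stepInterp (N : ℕ) (f : ℝ → ℂ) (y : ℝ) : ℂ :=
  ∑ j ∈ Finset.Icc (-(N : ℤ) ^ 2) ((N : ℤ) ^ 2), (gridCell N j).indicator (fun _ => f (j / N)) y

theorem stepInterp_eq (N : ℕ) (f : ℝ → ℂ) (y : ℝ) : stepInterp N f y =
    if ⌊(N : ℝ) * y⌋ ∈ Finset.Icc (-(N : ℤ) ^ 2) ((N : ℤ) ^ 2) then f (⌊(N : ℝ) * y⌋ / N)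
    else 0 := by
  simp only [stepInterp, gridCell, Set.indicator_apply, Set.mem_ofPred_eq, Finset.sum_ite_eq]

theorem locallyIntegrable_indicator_gridCell (N : ℕ) (j : ℤ) (c : ℂ) :
    LocallyIntegrable ((gridCell N j).indicator fun _ => c) :=
  (locallyIntegrable_const c).indicator (measurableSet_gridCell N j)

theorem locallyIntegrable_stepInterp (N : ℕ) (f : ℝ → ℂ) : LocallyIntegrable (stepInterp N f) :=
  locallyIntegrable_finsetSum _ fun j _ => locallyIntegrable_indicator_gridCell N j _

theorem norm_sub_stepInterp_le {f : ℝ → ℂ} (hf : Differentiable ℝ f) {k N : ℕ} (hN : 0 < N)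
    {M : ℝ} (hM : 0 ≤ M) (hf0 : ∀ y, ‖f y‖ ≤ M * Real.exp (-((k + 1 : ℕ) * |y|)))
    (hf' : ∀ y, ‖deriv f y‖ ≤ M * Real.exp (-(k * |y|))) (y : ℝ) :
    ‖f y - stepInterp N f y‖ ≤ M * (Real.exp k * Real.exp k + 1) / N * Real.exp (-(k * |y|)) := by
  have hN' : (0 : ℝ) < N := by exact_mod_cast hN
  have hN1 : (1 : ℝ) ≤ N := by exact_mod_cast hN
  rw [stepInterp_eq]
  split_ifs with h
  · have h1 : |y - ⌊(N : ℝ) * y⌋ / N| ≤ 1 / N := by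
      have ha := Int.floor_le ((N : ℝ) * y)
      have hb := Int.lt_floor_add_one ((N : ℝ) * y)
      have : y - ⌊(N : ℝ) * y⌋ / N = (N * y - ⌊(N : ℝ) * y⌋) / N := by field_simp
      rw [this, abs_of_nonneg (div_nonneg (by linarith) hN'.le)]
      gcongr
      linarith
    have hle : 1 / (N : ℝ) ≤ 1 := (div_le_one hN').2 hN1
    have h2 := norm_sub_le_of_norm_deriv_le_exp hf hM hf' hle h1
    have h3 := exp_neg_mul_abs_le k (x := y) (by rw [abs_sub_comm]; exact h1.trans hle)
    calc _ ≤ _ := h2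
      _ ≤ M * Real.exp k * (Real.exp k * Real.exp (-(k * |y|))) * (1 / N) := by gcongr
      _ = M * (Real.exp k * Real.exp k) / N * Real.exp (-(k * |y|)) := by ring
      _ ≤ _ := by gcongr; linarith
  · -- outside the grid `|y| ≥ N`, and the excess decay of `f` is at most `e^{-N} ≤ 1 / N`
    have hy : (N : ℝ) ≤ |y| := by
      by_contra! hlt
      apply h
      have h1 := abs_lt.1 hlt
      rw [Finset.mem_Icc]
      constructor
      · rw [Int.le_floor]
        push_cast
        nlinarith
      · refine Int.le_of_lt_add_one (Int.floor_lt.2 ?_)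
        push_cast
        nlinarith
    rw [sub_zero]
    have h1 : Real.exp (-((k + 1 : ℕ) * |y|)) ≤ 1 / N * Real.exp (-(k * |y|)) := by
      have h2 : Real.exp (-|y|) ≤ 1 / N := by
        rw [Real.exp_neg, ← one_div]
        gcongr
        linarith [Real.add_one_le_exp |y|]
      calc Real.exp (-((k + 1 : ℕ) * |y|)) = Real.exp (-|y|) * Real.exp (-(k * |y|)) := by
            rw [← Real.exp_add]
            congr 1
            push_cast
            ring
        _ ≤ _ := by gcongr
    calc ‖f y‖ ≤ M * (1 / N * Real.exp (-(k * |y|))) := (hf0 y).trans (by gcongr)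
      _ = M * 1 / N * Real.exp (-(k * |y|)) := by ring
      _ ≤ _ := by
        gcongr
        have : 0 ≤ Real.exp (k : ℝ) * Real.exp k := by positivity
        linarith

open Convolution in
theorem norm_convolution_le_of_exp {θ : ℝ → ℝ} (hθ : Continuous θ) (hc : HasCompactSupport θ)
    (hs : ∀ t, 1 < |t| → θ t = 0) {h : ℝ → ℂ} {k : ℕ} {M : ℝ} (hM : 0 ≤ M)
    (hh : ∀ y, ‖h y‖ ≤ M * Real.exp (-(k * |y|))) (x : ℝ) :
    ‖(θ ⋆[ContinuousLinearMap.lsmul ℝ ℝ] h) x‖ ≤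
      (∫ t, |θ t|) * (M * Real.exp k * Real.exp (-(k * |x|))) := by
  rw [← integral_mul_const]
  refine norm_integral_le_of_norm_le
    ((hθ.integrable_of_hasCompactSupport hc).abs.mul_const _)
    (Filter.Eventually.of_forall fun t => ?_)
  simp only [ContinuousLinearMap.lsmul_apply, norm_smul, Real.norm_eq_abs]
  rcases lt_or_ge 1 |t| with ht | ht
  · simp [hs t ht]
  · gcongr
    refine (hh _).trans ?_
    rw [mul_assoc]
    gcongr
    exact exp_neg_mul_abs_le k (by simpa using ht)

open Convolution in
/-- The mollified step interpolation approximates `f` together with its derivatives, because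
`f - η ⋆ P f = (f - η ⋆ f) + η ⋆ (f - P f)`: derivatives fall on `f` in the first difference and
on `η` in the second. -/
theorem norm_iteratedDeriv_sub_convolution_stepInterp_le (η : ContDiffBump (0 : ℝ))
    (hη : η.rOut ≤ 1) {f : ℝ → ℂ} (hf : ContDiff ℝ ∞ f) {k l N : ℕ} (hN : 0 < N)
    {M : ℝ} (hM : 0 ≤ M) (hf0 : ∀ y, ‖f y‖ ≤ M * Real.exp (-((k + 1 : ℕ) * |y|)))
    (hf1 : ∀ y, ‖deriv f y‖ ≤ M * Real.exp (-(k * |y|)))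
    (hfl : ∀ y, ‖iteratedDeriv (l + 1) f y‖ ≤ M * Real.exp (-(k * |y|))) (x : ℝ) :
    ‖iteratedDeriv l f x -
        iteratedDeriv l (η.normed volume ⋆[ContinuousLinearMap.lsmul ℝ ℝ] stepInterp N f) x‖ ≤
      M * Real.exp (-(k * |x|)) * (Real.exp k * η.rOut +
        (∫ t, |iteratedDeriv l (η.normed volume) t|) *
          ((Real.exp k * Real.exp k + 1) * Real.exp k) / N) := by
  have hηs : ContDiff ℝ ∞ (η.normed volume) := η.contDiff_normed
  have hηc : HasCompactSupport (η.normed volume) := η.hasCompactSupport_normed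
  have hfi : ContDiff ℝ ∞ (iteratedDeriv l f) := hf.iteratedDeriv l
  have hθ : Continuous (iteratedDeriv l (η.normed volume)) :=
    hηs.continuous_iteratedDeriv l (by exact_mod_cast le_top)
  rw [iteratedDeriv_convolution_left hηs hηc (locallyIntegrable_stepInterp N f)]
  have hA : ‖(iteratedDeriv l (η.normed volume) ⋆[ContinuousLinearMap.lsmul ℝ ℝ] f) x -
      iteratedDeriv l f x‖ ≤ M * Real.exp k * Real.exp (-(k * |x|)) * η.rOut := by
    rw [iteratedDeriv_convolution_eq hηs hηc hf, ← dist_eq_norm]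
    refine ContDiffBump.dist_normed_convolution_le hfi.continuous.aestronglyMeasurable
      fun y hy => ?_
    rw [dist_eq_norm]
    refine norm_sub_le_of_norm_deriv_le_exp (hfi.differentiable (by simp)) hM
      (fun y => ?_) hη ?_
    · rw [← iteratedDeriv_succ]
      exact hfl y
    · rw [Metric.mem_ball, Real.dist_eq] at hy
      exact hy.le
  have hB : ‖(iteratedDeriv l (η.normed volume) ⋆[ContinuousLinearMap.lsmul ℝ ℝ]
      (f - stepInterp N f)) x‖ ≤ (∫ t, |iteratedDeriv l (η.normed volume) t|) *
        (M * (Real.exp k * Real.exp k + 1) / N * Real.exp k * Real.exp (-(k * |x|))) := by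
    refine norm_convolution_le_of_exp hθ (hηc.iteratedDeriv l) (fun t ht => ?_) (by positivity)
      (norm_sub_stepInterp_le (hf.differentiable (by simp)) hN hM hf0 hf1) x
    have h1 : t ∉ tsupport (η.normed volume) := by
      rw [η.tsupport_normed_eq, Metric.mem_closedBall, Real.dist_eq, sub_zero]
      linarith
    exact image_eq_zero_of_notMem_tsupport fun h => h1 (tsupport_iteratedDeriv_subset _ l h)
  have hsub : (iteratedDeriv l (η.normed volume) ⋆[ContinuousLinearMap.lsmul ℝ ℝ]
      (f - stepInterp N f)) x =
      (iteratedDeriv l (η.normed volume) ⋆[ContinuousLinearMap.lsmul ℝ ℝ] f) x -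
      (iteratedDeriv l (η.normed volume) ⋆[ContinuousLinearMap.lsmul ℝ ℝ] stepInterp N f) x := by
    simp only [convolution, Pi.sub_apply, map_sub]
    exact integral_sub
      ((hηc.iteratedDeriv l).convolutionExists_left _ hθ hf.continuous.locallyIntegrable x)
      ((hηc.iteratedDeriv l).convolutionExists_left _ hθ (locallyIntegrable_stepInterp N f) x)
  rw [hsub] at hB
  refine (norm_sub_le_norm_sub_add_norm_sub _
    ((iteratedDeriv l (η.normed volume) ⋆[ContinuousLinearMap.lsmul ℝ ℝ] f) x) _).trans
    ((add_le_add ((norm_sub_rev _ _).trans_le hA) hB).trans (le_of_eq ?_))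
  ring

open Convolution in
/-- The mollified indicator functions of the grid cells, as elements of `𝒦₁(ℝ)`. -/
def mollifiedCell (η : ContDiffBump (0 : ℝ)) (N : ℕ) (hN : 0 < N) (j : ℤ) : K1 ℝ :=
  K1.ofHasCompactSupport
    (η.normed volume ⋆[ContinuousLinearMap.lsmul ℝ ℝ] (gridCell N j).indicator fun _ => (1 : ℂ))
    (η.hasCompactSupport_normed.contDiff_convolution_left _ η.contDiff_normed
      (locallyIntegrable_indicator_gridCell N j 1))
    (η.hasCompactSupport_normed.convolution _ (by
      refine HasCompactSupport.intro (isCompact_Icc (a := (j : ℝ) / N) (b := (j + 1) / N))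
        fun y hy => Set.indicator_of_notMem (fun h => hy ?_) _
      have hN' : (0 : ℝ) < N := by exact_mod_cast hN
      obtain ⟨h1, h2⟩ := Int.floor_eq_iff.1 h
      exact ⟨(div_le_iff₀' hN').2 h1, (le_div_iff₀' hN').2 h2.le⟩))

open Convolution in
theorem convolution_stepInterp (η : ContDiffBump (0 : ℝ)) {N : ℕ} (hN : 0 < N) (f : ℝ → ℂ) (x : ℝ) :
    (η.normed volume ⋆[ContinuousLinearMap.lsmul ℝ ℝ] stepInterp N f) x =
      ∑ j ∈ Finset.Icc (-(N : ℤ) ^ 2) ((N : ℤ) ^ 2), mollifiedCell η N hN j x * f (j / N) := by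
  have h : ∀ j, mollifiedCell η N hN j x * f (j / N) = (η.normed volume
      ⋆[ContinuousLinearMap.lsmul ℝ ℝ] (gridCell N j).indicator fun _ => f (j / N)) x := fun j => by
    change (η.normed volume ⋆[ContinuousLinearMap.lsmul ℝ ℝ]
      (gridCell N j).indicator fun _ => (1 : ℂ)) x * f (j / N) = _
    simp only [convolution, ← integral_mul_const]
    congr 1 with t
    by_cases ht : x - t ∈ gridCell N j <;> simp [ht]
  simp only [h, convolution]
  rw [← integral_finsetSum]
  · simp only [stepInterp, map_sum]
  · exact fun j _ => η.hasCompactSupport_normed.convolutionExists_left _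
      (η.contDiff_normed (n := 0)).continuous (locallyIntegrable_indicator_gridCell N j _) x

namespace KUFun

variable {n : ℕ}

/-- The slice `Φ(x, ·)`, an element of `𝒰(ℂⁿ)`. -/
def slice (Φ : KUFun n) (x : ℝ) : USpace n :=
  ⟨Φ x, Φ.differentiable x, fun k => ⟨KUFun.rho n (k, 0) Φ, by
    rintro _ ⟨z, rfl⟩
    refine le_trans ?_ (Φ.weight_le_rho k 0 x z.2)
    rw [iteratedDeriv_zero, uWeight]
    gcongr
    refine le_mul_of_one_le_left (by positivity) (Real.one_le_exp (by positivity))⟩⟩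

/-- The approximation of `Φ` by the sum of the `(η ⋆ 1_{I_j}) ⊗ Φ(j / N, ·)`, where
`I_j = [j / N, (j + 1) / N)`. -/
def approx (η : ContDiffBump (0 : ℝ)) (N : ℕ) (hN : 0 < N) (Φ : KUFun n) : KUFun n :=
  ∑ j ∈ Finset.Icc (-(N : ℤ) ^ 2) ((N : ℤ) ^ 2),
    pureTensor (mollifiedCell η N hN j) (Φ.slice (j / N))

theorem approx_mem_range (η : ContDiffBump (0 : ℝ)) (N : ℕ) (hN : 0 < N) (Φ : KUFun n) :
    approx η N hN Φ ∈ LinearMap.range (tensorMap n) :=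
  Submodule.sum_mem _ fun j _ => ⟨mollifiedCell η N hN j ⊗ₜ Φ.slice (j / N), by
    rw [tensorMap, TensorProduct.lift.tmul]
    rfl⟩

open Convolution in
theorem approx_apply (η : ContDiffBump (0 : ℝ)) (N : ℕ) (hN : 0 < N) (Φ : KUFun n) (x : ℝ)
    (z : CSpace n) : approx η N hN Φ x z =
      (η.normed volume ⋆[ContinuousLinearMap.lsmul ℝ ℝ] stepInterp N fun y => Φ y z) x := by
  rw [convolution_stepInterp η hN]
  let ev : KUFun n →+ ℂ :=
    { toFun := fun Ψ => Ψ x z, map_zero' := rfl, map_add' := fun _ _ => rfl }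
  exact map_sum ev _ _

open Convolution in
theorem rho_sub_approx_le (η : ContDiffBump (0 : ℝ)) (hη : η.rOut ≤ 1) (N : ℕ) (hN : 0 < N)
    (Φ : KUFun n) (k l : ℕ) : KUFun.rho n (k, l) (Φ - approx η N hN Φ) ≤
      (KUFun.rho n (k + 1, 0) Φ + KUFun.rho n (k, 1) Φ + KUFun.rho n (k, l + 1) Φ) *
        (Real.exp k * η.rOut + (∫ t, |iteratedDeriv l (η.normed volume) t|) *
          ((Real.exp k * Real.exp k + 1) * Real.exp k) / N) := by
  refine rho_le fun x z hz => ?_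
  set R := KUFun.rho n (k + 1, 0) Φ + KUFun.rho n (k, 1) Φ + KUFun.rho n (k, l + 1) Φ with hR
  set w := (1 + ‖z‖ ^ 2) ^ ((k : ℝ) / 2) with hw
  have hw0 : 0 < w := by positivity
  have hz' : z ∈ tube n (k + 1) := fun i => (hz i).trans (by push_cast; linarith)
  have h1 : 0 ≤ KUFun.rho n (k + 1, 0) Φ := apply_nonneg _ _
  have h2 : 0 ≤ KUFun.rho n (k, 1) Φ := apply_nonneg _ _
  have h3 : 0 ≤ KUFun.rho n (k, l + 1) Φ := apply_nonneg _ _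
  have key : ∀ (y a b : ℝ) (K : ℕ), Real.exp (K * |y|) * w * a ≤ b → b ≤ R →
      a ≤ R / w * Real.exp (-(K * |y|)) := fun y a b K hab hb => by
    rw [Real.exp_neg, div_mul_eq_mul_div, le_div_iff₀ hw0, ← div_eq_mul_inv,
      le_div_iff₀ (Real.exp_pos _)]
    calc a * w * Real.exp (K * |y|) = Real.exp (K * |y|) * w * a := by ring
      _ ≤ R := hab.trans hb
  have hΦ0 := fun y => Φ.weight_le_rho (k + 1) 0 y hz'
  have hΦ1 := fun y => Φ.weight_le_rho k 1 y hz
  simp only [iteratedDeriv_zero, iteratedDeriv_one] at hΦ0 hΦ1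
  have hmain := norm_iteratedDeriv_sub_convolution_stepInterp_le η hη (Φ.contDiff z)
    (k := k) (l := l) hN (M := R / w) (by positivity)
    (fun y => key y _ _ (k + 1) (le_trans (by
      gcongr
      refine Real.rpow_le_rpow_of_exponent_le (by nlinarith [sq_nonneg ‖z‖]) ?_
      push_cast
      linarith) (hΦ0 y)) (by linarith))
    (fun y => key y _ _ k (hΦ1 y) (by linarith))
    (fun y => key y _ _ k (Φ.weight_le_rho k (l + 1) y hz) (by linarith)) x
  have hsub : iteratedDeriv l (fun x => (Φ - approx η N hN Φ : KUFun n) x z) x =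
      iteratedDeriv l (fun x => Φ x z) x - iteratedDeriv l (η.normed volume
        ⋆[ContinuousLinearMap.lsmul ℝ ℝ, volume] (stepInterp N fun y => Φ y z)) x := by
    rw [← show (fun x => approx η N hN Φ x z) = _ from funext fun x => approx_apply η N hN Φ x z]
    exact iteratedDeriv_sub ((Φ.contDiff z).contDiffAt.of_le (by exact_mod_cast le_top))
      (((approx η N hN Φ).contDiff z).contDiffAt.of_le (by exact_mod_cast le_top))
  rw [hsub]
  refine (mul_le_mul_of_nonneg_left hmain (by positivity)).trans (le_of_eq ?_)
  rw [Real.exp_neg]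
  field_simp

end KUFun

/-- The algebraic tensor product `𝒦₁(ℝ) ⊗ 𝒰(ℂⁿ)` is dense in the space of all functions of two
variables with finite norms `ρ^l_k`. -/
theorem kTensorU_eq_top (n : ℕ) : KTensorU n = ⊤ := by
  refine Submodule.eq_top_iff'.2 fun Φ => ?_
  change Φ ∈ closure (LinearMap.range (tensorMap n) : Set (KUFun n))
  rw [mem_closure_iff_nhds]
  intro U hU
  obtain ⟨s, ε, hε, hs⟩ := ((KUFun.withSeminorms n).mem_nhds_iff Φ U).1 hU
  let R : ℕ × ℕ → ℝ := fun kl => KUFun.rho n (kl.1 + 1, 0) Φ + KUFun.rho n (kl.1, 1) Φ +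
    KUFun.rho n (kl.1, kl.2 + 1) Φ
  have h1 : ∀ᶠ r in nhdsWithin (0 : ℝ) (Set.Ioi 0), ∀ kl ∈ s, R kl * (Real.exp kl.1 * r) < ε := by
    refine (Filter.eventually_all_finset s).2 fun kl _ => ?_
    have : Filter.Tendsto (fun r : ℝ => R kl * (Real.exp kl.1 * r)) (nhds 0) (nhds 0) := by
      have := (by fun_prop : Continuous fun r : ℝ => R kl * (Real.exp kl.1 * r)).tendsto 0
      simpa using this
    exact nhdsWithin_le_nhds (this.eventually_lt_const hε)
  have h2 : ∀ᶠ r in nhdsWithin (0 : ℝ) (Set.Ioi 0), r ≤ 1 :=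
    nhdsWithin_le_nhds (eventually_le_nhds zero_lt_one)
  obtain ⟨r, ⟨hr, hr1⟩, hr0⟩ := ((h1.and h2).and self_mem_nhdsWithin).exists
  let η : ContDiffBump (0 : ℝ) := ⟨r / 2, r, half_pos hr0, half_lt_self hr0⟩
  have h3 : ∀ᶠ N : ℕ in Filter.atTop, ∀ kl ∈ s, R kl * (Real.exp kl.1 * η.rOut +
      (∫ t, |iteratedDeriv kl.2 (η.normed volume) t|) *
        ((Real.exp kl.1 * Real.exp kl.1 + 1) * Real.exp kl.1) / N) < ε := by
    refine (Filter.eventually_all_finset s).2 fun kl hkl => ?_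
    have := ((tendsto_const_div_atTop_nhds_zero_nat ((∫ t, |iteratedDeriv kl.2 (η.normed volume) t|)
      * ((Real.exp kl.1 * Real.exp kl.1 + 1) * Real.exp kl.1))).const_add
        (Real.exp kl.1 * η.rOut)).const_mul (R kl)
    rw [add_zero] at this
    exact this.eventually_lt_const (hr kl hkl)
  obtain ⟨N, hN, hN0⟩ := (h3.and (Filter.eventually_gt_atTop 0)).exists
  refine ⟨KUFun.approx η N hN0 Φ, hs ?_, KUFun.approx_mem_range η N hN0 Φ⟩
  rw [Seminorm.mem_ball, ← map_neg_eq_map, neg_sub]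
  exact Seminorm.finset_sup_apply_lt hε fun kl hkl =>
    (KUFun.rho_sub_approx_le η hr1 N hN0 Φ kl.1 kl.2).trans_lt (hN kl hkl)

/-! ### Integrability, and shifting the domain of integration in `ℂⁿ` -/

section Integrability

variable {E : Type*} [NormedAddCommGroup E] [NormedSpace ℝ E] [FiniteDimensional ℝ E]
  [MeasurableSpace E] [BorelSpace E] (μ : Measure E) [μ.IsAddHaarMeasure]

theorem integrable_one_add_norm_pow_inv {m : ℕ} (hm : Module.finrank ℝ E < m) :
    Integrable (fun t : E => ((1 + ‖t‖) ^ m)⁻¹) μ := by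
  have := integrable_one_add_norm (E := E) (μ := μ) (r := m) (by exact_mod_cast hm)
  refine this.congr (Filter.Eventually.of_forall fun t => ?_)
  simp only [Real.rpow_neg (by positivity : (0 : ℝ) ≤ 1 + ‖t‖), Real.rpow_natCast]

theorem integrable_exp_neg_mul_norm {m : ℕ} (hm : Module.finrank ℝ E < m) :
    Integrable (fun t : E => Real.exp (-(m * ‖t‖))) μ := by
  refine (integrable_one_add_norm_pow_inv μ hm).mono'
    (by fun_prop : Continuous fun t : E => Real.exp (-(m * ‖t‖))).aestronglyMeasurable
    (Filter.Eventually.of_forall fun t => ?_)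
  rw [Real.norm_of_nonneg (Real.exp_pos _).le, Real.exp_neg]
  exact inv_anti₀ (by positivity) (Real.one_add_pow_le_exp_mul m (norm_nonneg t))

end Integrability

section

variable {n : ℕ}

@[simp]
theorem realToComplex_apply (ξ : RSpace n) (j : Fin n) : realToComplex ξ j = (ξ j : ℂ) := rfl

theorem realToComplex_add (ξ η : RSpace n) :
    realToComplex (ξ + η) = realToComplex ξ + realToComplex η := by
  ext j
  simp

theorem realToComplex_smul (r : ℝ) (ξ : RSpace n) :
    realToComplex (r • ξ) = (r : ℂ) • realToComplex ξ := by
  ext j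
  simp

@[simp]
theorem norm_realToComplex (ξ : RSpace n) : ‖realToComplex ξ‖ = ‖ξ‖ := by
  simp [EuclideanSpace.norm_eq]

@[fun_prop]
theorem continuous_realToComplex : Continuous (realToComplex : RSpace n → CSpace n) := by
  unfold realToComplex
  fun_prop

theorem abs_coord_le (ξ : RSpace n) (j : Fin n) : |ξ j| ≤ ‖ξ‖ := PiLp.norm_apply_le ξ j

theorem realToComplex_mem_tube (ξ : RSpace n) (k : ℕ) : realToComplex ξ ∈ tube n k := fun j => by
  simp

theorem one_add_norm_pow_inv_le (a b : CSpace n) (m : ℕ) :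
    ((1 + ‖a + b‖) ^ m)⁻¹ ≤ (1 + ‖b‖) ^ m * ((1 + ‖a‖) ^ m)⁻¹ := by
  rw [← div_eq_mul_inv, le_div_iff₀ (by positivity), inv_mul_le_iff₀ (by positivity), ← mul_pow]
  gcongr
  have h : ‖a‖ ≤ ‖a + b‖ + ‖b‖ := by simpa using norm_sub_le (a + b) b
  nlinarith [norm_nonneg (a + b), norm_nonneg b, mul_nonneg (norm_nonneg (a + b)) (norm_nonneg b)]

theorem add_smul_realToComplex_mem_tube (ξ η : RSpace n) {w : ℂ} {k : ℕ}
    (h : ‖w‖ * ‖η‖ ≤ k) : realToComplex ξ + w • realToComplex η ∈ tube n k := fun j => by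
  simp only [PiLp.add_apply, PiLp.smul_apply, realToComplex_apply, smul_eq_mul, Complex.add_im,
    Complex.ofReal_im, zero_add, Complex.im_mul_ofReal, abs_mul]
  exact (mul_le_mul (Complex.abs_im_le_norm w) (abs_coord_le η j) (abs_nonneg _)
    (norm_nonneg _)).trans h

/-- The translates of the integral of an entire function over `ℝⁿ` into the complex domain all
agree: `w ↦ ∫ H(ξ + w η) dξ` is entire, and is invariant under real translations, so that its
derivative vanishes. -/
theorem integral_add_smul_realToComplex {H : CSpace n → ℂ} (hH : Differentiable ℂ H)
    {m : ℕ} (hm : n < m)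
    (hb : ∀ k : ℕ, ∃ C, ∀ z ∈ tube n k, ‖H z‖ ≤ C * ((1 + ‖z‖) ^ m)⁻¹) (η : RSpace n) (w : ℂ) :
    ∫ ξ : RSpace n, H (realToComplex ξ + w • realToComplex η) =
      ∫ ξ : RSpace n, H (realToComplex ξ) := by
  set W : ℂ → ℂ := fun w => ∫ ξ : RSpace n, H (realToComplex ξ + w • realToComplex η) with hW
  have hHc := hH.continuous
  have hcont : ∀ w : ℂ, Continuous fun ξ : RSpace n => H (realToComplex ξ + w • realToComplex η) :=
    fun w => hHc.comp (continuous_realToComplex.add continuous_const)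
  have hdiff : ∀ w, DifferentiableAt ℂ W w := by
    intro w₀
    obtain ⟨k, hk⟩ := exists_nat_ge ((‖w₀‖ + 2) * ‖η‖)
    obtain ⟨C, hC⟩ := hb k
    have hC0 : 0 ≤ C := by
      have := (norm_nonneg _).trans (hC 0 (zero_mem_tube n k))
      simpa using this
    have hlt : ∀ w : ℂ, dist w w₀ ≤ 2 → ‖w‖ ≤ ‖w₀‖ + 2 := fun w hw => by
      rw [dist_eq_norm] at hw
      have := norm_add_le w₀ (w - w₀)
      rw [add_sub_cancel] at this
      linarith
    let B : RSpace n → ℝ := fun ξ => C * ((1 + (‖w₀‖ + 2) * ‖η‖) ^ m * ((1 + ‖ξ‖) ^ m)⁻¹)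
    have hbd : ∀ (w : ℂ) (ξ : RSpace n), dist w w₀ ≤ 2 →
        ‖H (realToComplex ξ + w • realToComplex η)‖ ≤ B ξ := fun w ξ hw => by
      have h1 := hlt w hw
      have h2 : ‖w‖ * ‖η‖ ≤ (‖w₀‖ + 2) * ‖η‖ := by gcongr
      refine (hC _ (add_smul_realToComplex_mem_tube ξ η (h2.trans hk))).trans ?_
      have h3 := one_add_norm_pow_inv_le (realToComplex ξ) (w • realToComplex η) m
      rw [norm_smul, norm_realToComplex, norm_realToComplex] at h3
      dsimp only [B]
      gcongr
      exact h3.trans (by gcongr)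
    have hB : Integrable B :=
      ((integrable_one_add_norm_pow_inv volume (by simpa using hm)).const_mul _).const_mul _
    have hd : ∀ (ξ : RSpace n) (w : ℂ), HasDerivAt
        (fun w => H (realToComplex ξ + w • realToComplex η))
        (fderiv ℂ H (realToComplex ξ + w • realToComplex η) (realToComplex η)) w := fun ξ w => by
      have h1 : HasDerivAt (fun w : ℂ => realToComplex ξ + w • realToComplex η)
          (realToComplex η) w := by
        simpa using ((hasDerivAt_id w).smul_const (realToComplex η)).const_add (realToComplex ξ)
      exact (hH _).hasFDerivAt.comp_hasDerivAt w h1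
    refine (hasDerivAt_integral_of_dominated_loc_of_deriv_le (bound := B)
      (F' := fun w ξ => fderiv ℂ H (realToComplex ξ + w • realToComplex η) (realToComplex η))
      (Metric.ball_mem_nhds w₀ one_pos)
      (Filter.Eventually.of_forall fun w => (hcont w).aestronglyMeasurable)
      (hB.mono' (hcont w₀).aestronglyMeasurable (Filter.Eventually.of_forall fun ξ =>
        hbd w₀ ξ (by simp))) ?_ (Filter.Eventually.of_forall fun ξ w hw => ?_) hB
      (Filter.Eventually.of_forall fun ξ w _ => hd ξ w)).2.differentiableAt
    · exact ((measurable_fderiv_apply_const ℂ H (realToComplex η)).comp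
        (continuous_realToComplex.add continuous_const).measurable).aestronglyMeasurable
    · -- Cauchy's estimate on the unit disc around `w`
      rw [← (hd ξ w).deriv, ← div_one (B ξ)]
      refine Complex.norm_deriv_le_of_forall_mem_sphere_norm_le one_pos
        (Differentiable.diffContOnCl fun w => (hd ξ w).differentiableAt) fun v hv => hbd v ξ ?_
      rw [Metric.mem_sphere] at hv
      rw [Metric.mem_ball] at hw
      linarith [dist_triangle v w w₀]
  have hper : ∀ (w : ℂ) (r : ℝ), W (w + r) = W w := fun w r => by
    rw [hW]
    dsimp only
    rw [← integral_add_right_eq_self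
      (fun ξ : RSpace n => H (realToComplex ξ + w • realToComplex η)) (r • η)]
    congr 1 with ξ
    congr 1
    rw [realToComplex_add, realToComplex_smul, add_smul]
    abel
  have hzero : ∀ w, deriv W w = 0 := fun w => by
    have h1 : HasDerivAt (fun r : ℝ => W (w + r)) (deriv W w) 0 := by
      have h2 : HasDerivAt (fun v : ℂ => W (w + v)) (deriv W w) ((0 : ℝ) : ℂ) := by
        have := HasDerivAt.comp_const_add w ((0 : ℝ) : ℂ) (f := W) (f' := deriv W w)
          (by simpa using (hdiff w).hasDerivAt)
        exact this
      exact h2.comp_ofReal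
    simp only [hper] at h1
    exact h1.unique (hasDerivAt_const _ _)
  have := is_const_of_deriv_eq_zero hdiff hzero w 0
  simpa [hW] using this

theorem KUFun.stronglyMeasurable (Φ : KUFun n) :
    StronglyMeasurable fun p : ℝ × RSpace n => Φ p.1 (realToComplex p.2) :=
  stronglyMeasurable_uncurry_of_continuous_of_stronglyMeasurable
    (u := fun x (ξ : RSpace n) => Φ x (realToComplex ξ))
    (fun _ => (Φ.contDiff _).continuous)
    (fun x => ((Φ.differentiable x).continuous.comp continuous_realToComplex).stronglyMeasurable)

theorem KUFun.integrable (Φ : KUFun n) :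
    Integrable fun p : ℝ × RSpace n => Φ p.1 (realToComplex p.2) := by
  have h1 : Integrable fun x : ℝ => Real.exp (-((n + 2 : ℕ) * |x|)) := by
    simpa using integrable_exp_neg_mul_norm (volume : Measure ℝ) (m := n + 2) (by simp)
  have h2 : Integrable fun ξ : RSpace n => ((1 + ‖ξ‖) ^ (n + 2))⁻¹ :=
    integrable_one_add_norm_pow_inv volume (by simp)
  refine ((h1.mul_prod h2).const_mul (2 ^ (n + 2) * KUFun.rho n (n + 2, 0) Φ)).mono'
    Φ.stronglyMeasurable.aestronglyMeasurable (Filter.Eventually.of_forall fun p => ?_)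
  have := Φ.norm_le (n + 2) p.1 (realToComplex_mem_tube p.2 (n + 2))
  rw [norm_realToComplex] at this
  rw [← mul_assoc]
  exact this

end

/-! ### The directional synthesis operator on functions -/

section Synthesis

variable {n : ℕ}

/-- The linear form `t ↦ t_j`, with complex values. -/
def coordCLM (j : Fin n) : RSpace n →L[ℝ] ℂ := Complex.ofRealCLM.comp (EuclideanSpace.proj j)

@[simp]
theorem coordCLM_apply (j : Fin n) (t : RSpace n) : coordCLM j t = (t j : ℂ) := rfl

theorem norm_coordCLM_le (j : Fin n) : ‖coordCLM j‖ ≤ 1 :=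
  ContinuousLinearMap.opNorm_le_bound _ zero_le_one fun t => by
    simpa using abs_coord_le t j

theorem norm_synthIntegrand_le (h : K1 ℝ) (u : RSpace n) (Φ : KUFun n) (t : RSpace n) (x : ℝ)
    (ξ : RSpace n) : ‖synthIntegrand h u Φ t x ξ‖ ≤ ‖Φ x (realToComplex ξ)‖ * K1.rho ℝ 0 h := by
  rw [synthIntegrand, norm_mul, norm_mul]
  gcongr
  rw [Complex.norm_exp]
  simpa using h.norm_le_rho 0 _

theorem aestronglyMeasurable_synthIntegrand (h : K1 ℝ) (u : RSpace n) (Φ : KUFun n)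
    (t : RSpace n) :
    AEStronglyMeasurable fun p : ℝ × RSpace n => synthIntegrand h u Φ t p.1 p.2 := by
  have hc := h.continuous
  exact (Φ.stronglyMeasurable.mul (by fun_prop : Continuous fun p : ℝ × RSpace n =>
    Complex.exp (2 * Real.pi * Complex.I * (inner ℝ t p.2 : ℝ)) *
      h (inner ℝ u t - p.1)).stronglyMeasurable).aestronglyMeasurable

theorem integrable_synthIntegrand (h : K1 ℝ) (u : RSpace n) (Φ : KUFun n) (t : RSpace n) :
    Integrable fun p : ℝ × RSpace n => synthIntegrand h u Φ t p.1 p.2 :=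
  (Φ.integrable.norm.mul_const _).mono' (aestronglyMeasurable_synthIntegrand h u Φ t)
    (Filter.Eventually.of_forall fun p => norm_synthIntegrand_le h u Φ t p.1 p.2)

theorem synth_eq_integral_prod (h : K1 ℝ) (u : RSpace n) (Φ : KUFun n) (t : RSpace n) :
    synth h u Φ t = ∫ p : ℝ × RSpace n, synthIntegrand h u Φ t p.1 p.2 :=
  (integral_prod_symm _ (integrable_synthIntegrand h u Φ t)).symm

/-- The derivative of the integrand of `DS*_{h,u} Φ(t)` in `t`. -/
def synthIntegrandFDeriv (h : K1 ℝ) (u : RSpace n) (Φ : KUFun n) (t : RSpace n) (x : ℝ)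
    (ξ : RSpace n) : RSpace n →L[ℝ] ℂ :=
  ∑ j, (u j * synthIntegrand (K1.deriv h) u Φ t x ξ +
    2 * Real.pi * Complex.I * synthIntegrand h u (KUFun.mulCoord j Φ) t x ξ) • coordCLM j

theorem hasFDerivAt_synthIntegrand (h : K1 ℝ) (u : RSpace n) (Φ : KUFun n) (x : ℝ)
    (ξ t : RSpace n) : HasFDerivAt (fun t => synthIntegrand h u Φ t x ξ)
      (synthIntegrandFDeriv h u Φ t x ξ) t := by
  have h1 : HasFDerivAt (fun t : RSpace n => h (inner ℝ u t - x))
      ((innerSL ℝ u).smulRight (K1.deriv h (inner ℝ u t - x))) t := by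
    have := (h.hasDerivAt (inner ℝ u t - x)).hasFDerivAt.comp t
      (((innerSL ℝ u).hasFDerivAt (x := t)).sub_const x)
    exact this
  have h2 : HasFDerivAt (fun t : RSpace n => Complex.exp (2 * Real.pi * Complex.I *
      (inner ℝ t ξ : ℝ))) (Complex.exp (2 * Real.pi * Complex.I * (inner ℝ t ξ : ℝ)) •
        ((2 * Real.pi * Complex.I) • Complex.ofRealCLM.comp (innerSL ℝ ξ))) t := by
    have h3 : HasFDerivAt (fun t : RSpace n => ((inner ℝ t ξ : ℝ) : ℂ))
        (Complex.ofRealCLM.comp (innerSL ℝ ξ)) t := by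
      have := (Complex.ofRealCLM.comp (innerSL ℝ ξ)).hasFDerivAt (x := t)
      refine this.congr_of_eventuallyEq (Filter.Eventually.of_forall fun t => ?_)
      simp [real_inner_comm]
    exact (h3.const_mul _).cexp
  refine ((h2.mul h1).const_mul (Φ x (realToComplex ξ))).congr_fderiv ?_
  ext v
  have hin : ∀ a : RSpace n, ((inner ℝ a v : ℝ) : ℂ) = ∑ j, (a j : ℂ) * (v j : ℂ) := fun a => by
    rw [PiLp.inner_apply]
    push_cast
    exact Finset.sum_congr rfl fun j _ => by simp [mul_comm]
  simp only [synthIntegrandFDeriv, _root_.smul_apply, _root_.add_apply,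
    ContinuousLinearMap.smulRight_apply, ContinuousLinearMap.comp_apply, innerSL_apply_apply,
    Complex.ofRealCLM_apply, _root_.sum_apply, coordCLM_apply, smul_eq_mul,
    Complex.real_smul, synthIntegrand, KUFun.mulCoord_apply, hin, realToComplex_apply]
  simp only [Finset.mul_sum, Finset.sum_mul, ← Finset.sum_add_distrib]
  exact Finset.sum_congr rfl fun j _ => by ring

theorem norm_synthIntegrandFDeriv_le (h : K1 ℝ) (u : RSpace n) (Φ : KUFun n) (t : RSpace n)
    (x : ℝ) (ξ : RSpace n) : ‖synthIntegrandFDeriv h u Φ t x ξ‖ ≤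
      ∑ j, (‖(u j : ℂ)‖ * (‖Φ x (realToComplex ξ)‖ * K1.rho ℝ 0 (K1.deriv h)) +
        ‖2 * Real.pi * Complex.I‖ *
          (‖KUFun.mulCoord j Φ x (realToComplex ξ)‖ * K1.rho ℝ 0 h)) := by
  refine norm_sum_le_of_le _ fun j _ => ?_
  rw [norm_smul]
  refine (mul_le_of_le_one_right (norm_nonneg _) (norm_coordCLM_le j)).trans ?_
  refine (norm_add_le _ _).trans (add_le_add ?_ ?_)
  · rw [norm_mul]
    exact mul_le_mul_of_nonneg_left (norm_synthIntegrand_le _ u Φ t x ξ) (norm_nonneg _)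
  · rw [norm_mul]
    exact mul_le_mul_of_nonneg_left (norm_synthIntegrand_le h u _ t x ξ) (norm_nonneg _)

theorem integrable_synthIntegrandFDeriv_term (h : K1 ℝ) (u : RSpace n) (Φ : KUFun n)
    (t : RSpace n) (j : Fin n) : Integrable fun p : ℝ × RSpace n =>
      (u j * synthIntegrand (K1.deriv h) u Φ t p.1 p.2 + 2 * Real.pi * Complex.I *
        synthIntegrand h u (KUFun.mulCoord j Φ) t p.1 p.2) :=
  ((integrable_synthIntegrand _ u Φ t).const_mul _).add
    ((integrable_synthIntegrand h u _ t).const_mul _)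

theorem aestronglyMeasurable_synthIntegrandFDeriv (h : K1 ℝ) (u : RSpace n) (Φ : KUFun n)
    (t : RSpace n) :
    AEStronglyMeasurable fun p : ℝ × RSpace n => synthIntegrandFDeriv h u Φ t p.1 p.2 := by
  unfold synthIntegrandFDeriv
  exact Finset.aestronglyMeasurable_fun_sum _ fun j _ =>
    (integrable_synthIntegrandFDeriv_term h u Φ t j).aestronglyMeasurable.smul_const _

theorem integral_synthIntegrandFDeriv (h : K1 ℝ) (u : RSpace n) (Φ : KUFun n) (t : RSpace n) :
    ∫ p : ℝ × RSpace n, synthIntegrandFDeriv h u Φ t p.1 p.2 =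
      ∑ j, (u j * synth (K1.deriv h) u Φ t +
        2 * Real.pi * Complex.I * synth h u (KUFun.mulCoord j Φ) t) • coordCLM j := by
  unfold synthIntegrandFDeriv
  rw [integral_finsetSum _ fun j _ =>
    (integrable_synthIntegrandFDeriv_term h u Φ t j).smul_const _]
  refine Finset.sum_congr rfl fun j _ => ?_
  rw [integral_smul_const, integral_add ((integrable_synthIntegrand _ u Φ t).const_mul _)
    ((integrable_synthIntegrand h u _ t).const_mul _), integral_const_mul, integral_const_mul,
    synth_eq_integral_prod, synth_eq_integral_prod]

/-- Every partial derivative of `DS*_{h,u} Φ` is a combination of functions of the same type, for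
`h'` and `Φ` or for `h` and `z_j Φ`. -/
theorem hasFDerivAt_synth (h : K1 ℝ) (u : RSpace n) (Φ : KUFun n) (t : RSpace n) :
    HasFDerivAt (synth h u Φ) (∑ j, (u j * synth (K1.deriv h) u Φ t +
      2 * Real.pi * Complex.I * synth h u (KUFun.mulCoord j Φ) t) • coordCLM j) t := by
  rw [← integral_synthIntegrandFDeriv,
    show synth h u Φ = _ from funext (synth_eq_integral_prod h u Φ)]
  have hB : Integrable fun p : ℝ × RSpace n =>
      ∑ j, (‖(u j : ℂ)‖ * (‖Φ p.1 (realToComplex p.2)‖ * K1.rho ℝ 0 (K1.deriv h)) +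
        ‖2 * Real.pi * Complex.I‖ *
          (‖KUFun.mulCoord j Φ p.1 (realToComplex p.2)‖ * K1.rho ℝ 0 h)) :=
    integrable_finsetSum _ fun j _ => ((Φ.integrable.norm.mul_const _).const_mul _).add
      (((KUFun.mulCoord j Φ).integrable.norm.mul_const _).const_mul _)
  exact hasFDerivAt_integral_of_dominated_of_fderiv_le (𝕜 := ℝ)
    (F := fun t (p : ℝ × RSpace n) => synthIntegrand h u Φ t p.1 p.2)
    (F' := fun t (p : ℝ × RSpace n) => synthIntegrandFDeriv h u Φ t p.1 p.2)
    (s := Set.univ) Filter.univ_mem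
    (Filter.Eventually.of_forall fun t => aestronglyMeasurable_synthIntegrand h u Φ t)
    (integrable_synthIntegrand h u Φ t) (aestronglyMeasurable_synthIntegrandFDeriv h u Φ t)
    (Filter.Eventually.of_forall fun p t _ => norm_synthIntegrandFDeriv_le h u Φ t p.1 p.2) hB
    (Filter.Eventually.of_forall fun p t _ => hasFDerivAt_synthIntegrand h u Φ p.1 p.2 t)

theorem contDiff_synth (h : K1 ℝ) (u : RSpace n) (Φ : KUFun n) : ContDiff ℝ ∞ (synth h u Φ) := by
  refine contDiff_infty.2 fun m => ?_
  induction m generalizing h Φ with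
  | zero =>
    exact contDiff_zero.2 (continuous_iff_continuousAt.2 fun t =>
      (hasFDerivAt_synth h u Φ t).continuousAt)
  | succ m ih =>
    refine contDiff_succ_iff_hasFDerivAt.2 ⟨_, ?_, hasFDerivAt_synth h u Φ⟩
    exact ContDiff.sum fun j _ => ((contDiff_const.mul (ih _ Φ)).add
      (contDiff_const.mul (ih h _))).smul contDiff_const

theorem bidot_realToComplex (t ξ : RSpace n) : bidot t (realToComplex ξ) = (inner ℝ t ξ : ℝ) := by
  rw [bidot, PiLp.inner_apply]
  push_cast
  exact Finset.sum_congr rfl fun j _ => by simp [mul_comm]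

theorem bidot_add (t : RSpace n) (z w : CSpace n) : bidot t (z + w) = bidot t z + bidot t w := by
  simp [bidot, mul_add, Finset.sum_add_distrib]

theorem bidot_smul (t : RSpace n) (c : ℂ) (z : CSpace n) : bidot t (c • z) = c * bidot t z := by
  simp only [bidot, PiLp.smul_apply, smul_eq_mul, Finset.mul_sum]
  exact Finset.sum_congr rfl fun j _ => by ring

theorem bidot_im (t : RSpace n) (z : CSpace n) : (bidot t z).im = ∑ j, t j * (z j).im := by
  simp [bidot]

theorem abs_bidot_im_le (t : RSpace n) {z : CSpace n} {k : ℕ} (hz : z ∈ tube n k) :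
    |(bidot t z).im| ≤ n * k * ‖t‖ := by
  rw [bidot_im]
  refine (Finset.abs_sum_le_sum_abs _ _).trans ?_
  calc ∑ j, |t j * (z j).im| ≤ ∑ _j : Fin n, ‖t‖ * k := Finset.sum_le_sum fun j _ => by
        rw [abs_mul]
        exact mul_le_mul (abs_coord_le t j) (hz j) (abs_nonneg _) (norm_nonneg _)
    _ = n * k * ‖t‖ := by simp; ring

theorem differentiable_bidot (t : RSpace n) : Differentiable ℂ (bidot t) := by
  unfold bidot
  fun_prop

/-- Shifting the domain of integration to `ℝⁿ + iη` with `η` a multiple of `t` yields the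
exponential decay of `DS*Φ(t)`. -/
theorem exp_mul_norm_synth_le (h : K1 ℝ) (u : RSpace n) (k : ℕ) : ∃ C : ℝ, 0 ≤ C ∧
    ∀ (Φ : KUFun n) (t : RSpace n), Real.exp (k * ‖t‖) * ‖synth h u Φ t‖ ≤
      C * KUFun.rho n (k + n + 2, 0) Φ := by
  set K := k + n + 2 with hK
  have hx : Integrable fun x : ℝ => Real.exp (-(K * |x|)) := by
    simpa using integrable_exp_neg_mul_norm (volume : Measure ℝ) (m := K) (by simp [hK])
  have hξ : Integrable fun ξ : RSpace n => ((1 + ‖ξ‖) ^ K)⁻¹ :=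
    integrable_one_add_norm_pow_inv volume (by simp [hK]; omega)
  refine ⟨(∫ x : ℝ, Real.exp (-(K * |x|))) * (∫ ξ : RSpace n, ((1 + ‖ξ‖) ^ K)⁻¹) *
    (2 ^ K * K1.rho ℝ 0 h), by positivity, fun Φ t => ?_⟩
  obtain ⟨η, hη, hηt⟩ : ∃ η : RSpace n, ‖η‖ ≤ k ∧ inner ℝ t η = k * ‖t‖ := by
    rcases eq_or_ne t 0 with rfl | ht
    · exact ⟨0, by simp, by simp⟩
    · have ht' := norm_ne_zero_iff.2 ht
      refine ⟨(k / ‖t‖) • t, ?_, ?_⟩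
      · rw [norm_smul, norm_div, norm_norm, div_mul_cancel₀ _ ht']
        simp
      · rw [inner_smul_right, real_inner_self_eq_norm_sq]
        field_simp
  -- the inner integral, over `ξ`
  have hin : ∀ x : ℝ, ‖∫ ξ : RSpace n, synthIntegrand h u Φ t x ξ‖ ≤
      Real.exp (-(K * |x|)) * ((∫ ξ : RSpace n, ((1 + ‖ξ‖) ^ K)⁻¹) *
        (2 ^ K * K1.rho ℝ 0 h) * KUFun.rho n (K, 0) Φ * Real.exp (-(k * ‖t‖))) := fun x => by
    set H : CSpace n → ℂ := fun z => Φ x z *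
      (Complex.exp (2 * Real.pi * Complex.I * bidot t z) * h (inner ℝ u t - x)) with hH
    have hnorm : ∀ z, ‖H z‖ = ‖Φ x z‖ * (Real.exp (-(2 * Real.pi * (bidot t z).im)) *
        ‖h (inner ℝ u t - x)‖) := fun z => by
      rw [hH, norm_mul, norm_mul, Complex.norm_exp]
      simp
    have hHd : Differentiable ℂ H := (Φ.differentiable x).mul
      ((((differentiable_bidot t).const_mul _).cexp).mul (differentiable_const _))
    -- decay of order `K` on the tube `Π_k'` comes from the norm of index `K + k'`
    have hshift := integral_add_smul_realToComplex hHd (m := K) (by omega) (fun k' => by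
      refine ⟨2 ^ (K + k') * KUFun.rho n (K + k', 0) Φ * (Real.exp (2 * Real.pi *
        (n * k' * ‖t‖)) * K1.rho ℝ 0 h), fun z hz => ?_⟩
      have hz' : z ∈ tube n (K + k') := fun i => (hz i).trans (by push_cast; linarith)
      rw [hnorm]
      have h1 : ‖Φ x z‖ ≤ 2 ^ (K + k') * KUFun.rho n (K + k', 0) Φ * ((1 + ‖z‖) ^ K)⁻¹ := by
        refine (Φ.norm_le (K + k') x hz').trans ?_
        have h2 : Real.exp (-((K + k' : ℕ) * |x|)) ≤ 1 := by
          rw [Real.exp_le_one_iff, Left.neg_nonpos_iff]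
          positivity
        have h3 : ((1 + ‖z‖) ^ (K + k'))⁻¹ ≤ ((1 + ‖z‖) ^ K)⁻¹ := by
          refine inv_anti₀ (by positivity) (pow_le_pow_right₀ ?_ (by omega))
          linarith [norm_nonneg z]
        calc _ ≤ 2 ^ (K + k') * KUFun.rho n (K + k', 0) Φ * 1 * ((1 + ‖z‖) ^ K)⁻¹ := by gcongr
          _ = _ := by ring
      have h4 : Real.exp (-(2 * Real.pi * (bidot t z).im)) ≤
          Real.exp (2 * Real.pi * (n * k' * ‖t‖)) := by
        rw [← mul_neg]
        gcongr
        exact (neg_le_abs _).trans (abs_bidot_im_le t hz)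
      calc ‖Φ x z‖ * (Real.exp (-(2 * Real.pi * (bidot t z).im)) * ‖h (inner ℝ u t - x)‖)
          ≤ 2 ^ (K + k') * KUFun.rho n (K + k', 0) Φ * ((1 + ‖z‖) ^ K)⁻¹ *
            (Real.exp (2 * Real.pi * (n * k' * ‖t‖)) * K1.rho ℝ 0 h) := by
            gcongr
            exact h.norm_le_rho 0 _
        _ = _ := by ring) η Complex.I
    have hreal : ∫ ξ : RSpace n, synthIntegrand h u Φ t x ξ =
        ∫ ξ : RSpace n, H (realToComplex ξ) := by
      simp only [synthIntegrand, hH, bidot_realToComplex]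
    rw [hreal, ← hshift]
    have hbound : ∀ ξ : RSpace n, ‖H (realToComplex ξ + Complex.I • realToComplex η)‖ ≤
        ((1 + ‖ξ‖) ^ K)⁻¹ * ((2 ^ K * K1.rho ℝ 0 h) * KUFun.rho n (K, 0) Φ *
          Real.exp (-(k * ‖t‖)) * Real.exp (-(K * |x|))) := fun ξ => by
      have hz : realToComplex ξ + Complex.I • realToComplex η ∈ tube n K :=
        add_smul_realToComplex_mem_tube ξ η (by
          rw [Complex.norm_I, one_mul]
          exact hη.trans (by rw [hK]; push_cast; linarith))
      have him : (bidot t (realToComplex ξ + Complex.I • realToComplex η)).im = k * ‖t‖ := by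
        rw [bidot_add, bidot_smul, bidot_realToComplex, bidot_realToComplex, hηt]
        simp
      rw [hnorm, him]
      have h1 : ‖ξ‖ ≤ ‖realToComplex ξ + Complex.I • realToComplex η‖ := by
        rw [EuclideanSpace.norm_eq, EuclideanSpace.norm_eq]
        refine Real.sqrt_le_sqrt (Finset.sum_le_sum fun j _ => ?_)
        have := Complex.abs_re_le_norm ((realToComplex ξ + Complex.I • realToComplex η) j)
        simp only [PiLp.add_apply, PiLp.smul_apply, realToComplex_apply, smul_eq_mul,
          Complex.add_re, Complex.ofReal_re, Complex.I_mul_re, Complex.ofReal_im, neg_zero,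
          add_zero] at this ⊢
        gcongr
        exact this
      have h2 : Real.exp (-(2 * Real.pi * (k * ‖t‖))) ≤ Real.exp (-(k * ‖t‖)) := by
        refine Real.exp_le_exp.2 (neg_le_neg ?_)
        have : 0 ≤ k * ‖t‖ := by positivity
        nlinarith [Real.pi_gt_three]
      calc _ ≤ 2 ^ K * KUFun.rho n (K, 0) Φ * Real.exp (-(K * |x|)) * ((1 + ‖ξ‖) ^ K)⁻¹ *
            (Real.exp (-(k * ‖t‖)) * K1.rho ℝ 0 h) := by
            gcongr
            · refine (Φ.norm_le K x hz).trans ?_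
              gcongr
            · exact h.norm_le_rho 0 _
        _ = _ := by ring
    refine (norm_integral_le_of_norm_le (hξ.mul_const _)
      (Filter.Eventually.of_forall hbound)).trans (le_of_eq ?_)
    rw [integral_mul_const]
    ring
  have hout : ‖synth h u Φ t‖ ≤ ∫ x : ℝ, Real.exp (-(K * |x|)) *
      ((∫ ξ : RSpace n, ((1 + ‖ξ‖) ^ K)⁻¹) * (2 ^ K * K1.rho ℝ 0 h) * KUFun.rho n (K, 0) Φ *
        Real.exp (-(k * ‖t‖))) := by
    rw [synth_eq_integral_prod]
    have := integral_prod (μ := (volume : Measure ℝ)) (ν := (volume : Measure (RSpace n))) _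
      (integrable_synthIntegrand h u Φ t)
    rw [show ∫ p : ℝ × RSpace n, synthIntegrand h u Φ t p.1 p.2 = _ from this]
    exact norm_integral_le_of_norm_le (hx.mul_const _) (Filter.Eventually.of_forall hin)
  rw [integral_mul_const, Real.exp_neg (k * ‖t‖)] at hout
  calc _ ≤ Real.exp (k * ‖t‖) * _ := mul_le_mul_of_nonneg_left hout (Real.exp_pos _).le
    _ = _ := by field_simp

theorem norm_iteratedFDeriv_sum_le {E F ι : Type*} [NormedAddCommGroup E] [NormedSpace ℝ E]
    [NormedAddCommGroup F] [NormedSpace ℝ F] [Fintype ι] {f : ι → E → F}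
    (hf : ∀ j, ContDiff ℝ ∞ (f j)) (m : ℕ) (t : E) :
    ‖iteratedFDeriv ℝ m (fun t => ∑ j, f j t) t‖ ≤ ∑ j, ‖iteratedFDeriv ℝ m (f j) t‖ := by
  rw [iteratedFDeriv_sum fun j _ => (hf j).of_le (by exact_mod_cast le_top), Finset.sum_apply]
  exact norm_sum_le _ _

theorem norm_iteratedFDeriv_smul_const_le {E F : Type*} [NormedAddCommGroup E] [NormedSpace ℝ E]
    [NormedAddCommGroup F] [NormedSpace ℝ F] [NormedSpace ℂ F] [IsScalarTower ℝ ℂ F] {f : E → ℂ}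
    (hf : ContDiff ℝ ∞ f) (m : ℕ) (c : F) (t : E) :
    ‖iteratedFDeriv ℝ m (fun t => f t • c) t‖ ≤ ‖c‖ * ‖iteratedFDeriv ℝ m f t‖ := by
  have := ((ContinuousLinearMap.toSpanSingleton ℂ c).restrictScalars
    ℝ).norm_iteratedFDeriv_comp_left (n := m) (hf.contDiffAt (x := t)) (by exact_mod_cast le_top)
  rwa [ContinuousLinearMap.norm_restrictScalars, ContinuousLinearMap.norm_toSpanSingleton] at this

theorem norm_iteratedFDeriv_linear_combination_le {E : Type*} [NormedAddCommGroup E]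
    [NormedSpace ℝ E] {f g : E → ℂ} (hf : ContDiff ℝ ∞ f) (hg : ContDiff ℝ ∞ g) (a b : ℂ) (m : ℕ)
    (t : E) : ‖iteratedFDeriv ℝ m (fun t => a * f t + b * g t) t‖ ≤
      ‖a‖ * ‖iteratedFDeriv ℝ m f t‖ + ‖b‖ * ‖iteratedFDeriv ℝ m g t‖ := by
  have hf' : ContDiffAt ℝ m f t := hf.contDiffAt.of_le (by exact_mod_cast le_top)
  have hg' : ContDiffAt ℝ m g t := hg.contDiffAt.of_le (by exact_mod_cast le_top)
  have h : iteratedFDeriv ℝ m (fun t => a * f t + b * g t) t =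
      a • iteratedFDeriv ℝ m f t + b • iteratedFDeriv ℝ m g t := by
    rw [← iteratedFDeriv_const_smul_apply hf', ← iteratedFDeriv_const_smul_apply hg']
    exact iteratedFDeriv_add_apply (hf'.const_smul a) (hg'.const_smul b)
  rw [h, ← norm_smul, ← norm_smul]
  exact norm_add_le _ _

/-- The decay of all derivatives follows from that of the function itself by induction, as the
operators `Φ ↦ z_j Φ` are continuous. -/
theorem exp_mul_norm_iteratedFDeriv_synth_le (h : K1 ℝ) (u : RSpace n) (k m : ℕ) :
    ∃ p : Seminorm ℂ (KUFun n), Continuous p ∧ ∀ (Φ : KUFun n) (t : RSpace n),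
      Real.exp (k * ‖t‖) * ‖iteratedFDeriv ℝ m (synth h u Φ) t‖ ≤ p Φ := by
  induction m generalizing h with
  | zero =>
    obtain ⟨C, hC0, hC⟩ := exp_mul_norm_synth_le h u k
    refine ⟨C.toNNReal • KUFun.rho n (k + n + 2, 0),
      ((KUFun.withSeminorms n).continuous_seminorm _).const_smul _, fun Φ t => ?_⟩
    rw [norm_iteratedFDeriv_zero, _root_.smul_apply, NNReal.smul_def, Real.coe_toNNReal _ hC0]
    exact hC Φ t
  | succ m ih =>
    obtain ⟨p, hpc, hp⟩ := ih (K1.deriv h)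
    obtain ⟨q, hqc, hq⟩ := ih h
    let a : Fin n → NNReal := fun j => ‖(u j : ℂ)‖₊
    let b : NNReal := ‖(2 * Real.pi * Complex.I : ℂ)‖₊
    let P : Fin n → Seminorm ℂ (KUFun n) := fun j =>
      a j • p + b • q.comp (KUFun.mulCoord j).toLinearMap
    have hsum : ⇑(∑ j, P j) = fun Φ => ∑ j, P j Φ := funext fun Φ => by
      rw [← FunLike.coeAddMonoidHom_apply, map_sum, Finset.sum_apply]
      rfl
    refine ⟨∑ j, P j, ?_, fun Φ t => ?_⟩
    · rw [hsum]
      exact continuous_finsetSum _ fun j _ => (hpc.const_smul (a j)).add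
        ((hqc.comp (KUFun.mulCoord j).continuous).const_smul b)
    · have hf : ∀ j, ContDiff ℝ ∞ fun t => (u j * synth (K1.deriv h) u Φ t +
          2 * Real.pi * Complex.I * synth h u (KUFun.mulCoord j Φ) t) := fun j =>
        (contDiff_const.mul (contDiff_synth _ u Φ)).add
          (contDiff_const.mul (contDiff_synth h u _))
      rw [hsum, ← norm_iteratedFDeriv_fderiv,
        show fderiv ℝ (synth h u Φ) = _ from funext fun t => (hasFDerivAt_synth h u Φ t).fderiv]
      refine (mul_le_mul_of_nonneg_left (norm_iteratedFDeriv_sum_le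
        (fun j => (hf j).smul contDiff_const) m t) (Real.exp_pos _).le).trans ?_
      rw [Finset.mul_sum]
      refine Finset.sum_le_sum fun j _ => ?_
      have h1 := (norm_iteratedFDeriv_smul_const_le (hf j) m (coordCLM j) t).trans
        (mul_le_of_le_one_left (norm_nonneg _) (norm_coordCLM_le j))
      have h2 := norm_iteratedFDeriv_linear_combination_le (contDiff_synth (K1.deriv h) u Φ)
        (contDiff_synth h u (KUFun.mulCoord j Φ)) (u j) (2 * Real.pi * Complex.I) m t
      calc _ ≤ Real.exp (k * ‖t‖) * _ :=
            mul_le_mul_of_nonneg_left (h1.trans h2) (Real.exp_pos _).le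
        _ = ‖(u j : ℂ)‖ * (Real.exp (k * ‖t‖) *
              ‖iteratedFDeriv ℝ m (synth (K1.deriv h) u Φ) t‖) +
            ‖2 * Real.pi * Complex.I‖ * (Real.exp (k * ‖t‖) *
              ‖iteratedFDeriv ℝ m (synth h u (KUFun.mulCoord j Φ)) t‖) := by ring
        _ ≤ ‖(u j : ℂ)‖ * p Φ + ‖2 * Real.pi * Complex.I‖ * q (KUFun.mulCoord j Φ) :=
            add_le_add (mul_le_mul_of_nonneg_left (hp Φ t) (norm_nonneg _))
              (mul_le_mul_of_nonneg_left (hq _ t) (norm_nonneg _))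
        _ = P j Φ := rfl

/-- The directional synthesis operator `DS*_{h,u}` as a continuous linear map into `𝒦₁(ℝⁿ)`. -/
def synthCLM (h : K1 ℝ) (u : RSpace n) : KUFun n →L[ℂ] K1 (RSpace n) :=
  K1.mkCLM
    { toFun := fun Φ => synth h u Φ
      map_add' := fun Φ Ψ => funext fun t => by
        simp only [Pi.add_apply, synth_eq_integral_prod]
        rw [← integral_add (integrable_synthIntegrand h u Φ t) (integrable_synthIntegrand h u Ψ t)]
        congr 1 with p
        exact add_mul _ _ _
      map_smul' := fun c Φ => funext fun t => by
        simp only [Pi.smul_apply, synth_eq_integral_prod, RingHom.id_apply]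
        rw [← integral_smul]
        congr 1 with p
        exact mul_assoc _ _ _ }
    (fun Φ => contDiff_synth h u Φ) (exp_mul_norm_iteratedFDeriv_synth_le h u)

end Synthesis

/-! ### The directional short-time Fourier transform of functions -/

section Analysis

variable {n : ℕ}

theorem dstftIntegrand_conj (h : K1 ℝ) (u : RSpace n) (f : RSpace n → ℂ) (x : ℝ) (z : CSpace n)
    (t : RSpace n) : dstftIntegrand (fun s => conj (h s)) u f x z t =
      f t * h (inner ℝ u t - x) * Complex.exp (-2 * Real.pi * Complex.I * bidot t z) := by
  simp [dstftIntegrand]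

theorem mem_tube_of_norm_le {z : CSpace n} {k : ℕ} (h : ‖z‖ ≤ k) : z ∈ tube n k := fun j =>
  (Complex.abs_im_le_norm _).trans ((KUFun.norm_coord_le z j).trans h)

theorem norm_exp_bidot_le (t : RSpace n) {z : CSpace n} {k : ℕ} (hz : z ∈ tube n k) :
    ‖Complex.exp (-2 * Real.pi * Complex.I * bidot t z)‖ ≤
      Real.exp ((7 * n * k : ℕ) * ‖t‖) := by
  rw [Complex.norm_exp]
  refine Real.exp_le_exp.2 ?_
  have h1 : (-2 * Real.pi * Complex.I * bidot t z).re = 2 * Real.pi * (bidot t z).im := by simp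
  have h2 := abs_bidot_im_le t hz
  have h3 : 0 ≤ n * k * ‖t‖ := by positivity
  have h4 := le_abs_self (bidot t z).im
  have h5 := Real.pi_lt_d2
  rw [h1]
  push_cast
  calc 2 * Real.pi * (bidot t z).im ≤ 2 * Real.pi * (n * k * ‖t‖) := by
        gcongr
        exact h4.trans h2
    _ ≤ 7 * (n * k * ‖t‖) := by gcongr; linarith
    _ = _ := by ring

/-- The decay of `φ` absorbs the growth of the exponential, and the weight `e^{k|x|}` is shared
between `φ(t)` and `h(u · t - x)`. -/
theorem exp_mul_norm_dstftIntegrand_le (h : K1 ℝ) {u : RSpace n} (hu : ‖u‖ = 1)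
    (φ : K1 (RSpace n)) (x : ℝ) {z : CSpace n} {k : ℕ} (hz : z ∈ tube n k) (N : ℕ)
    (t : RSpace n) :
    Real.exp (k * |x|) * ‖dstftIntegrand (fun s => conj (h s)) u φ x z t‖ ≤
      K1.rho ℝ k h * K1.rho (RSpace n) (k + 7 * n * k + N) φ * Real.exp (-(N * ‖t‖)) := by
  rw [dstftIntegrand_conj, norm_mul, norm_mul]
  have hx : Real.exp (k * |x|) ≤ Real.exp (k * ‖t‖) * Real.exp (k * ‖inner ℝ u t - x‖) := by
    rw [← Real.exp_add, ← mul_add]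
    gcongr
    have h1 : |inner ℝ u t| ≤ ‖t‖ := by simpa [hu] using abs_real_inner_le_norm u t
    have h2 := abs_sub_abs_le_abs_sub x (inner ℝ u t)
    rw [abs_sub_comm] at h2
    rw [Real.norm_eq_abs]
    linarith
  have h1 := h.exp_mul_norm_le k (inner ℝ u t - x)
  have h2 := φ.norm_le (k + 7 * n * k + N) t
  calc Real.exp (k * |x|) * (‖φ t‖ * ‖h (inner ℝ u t - x)‖ *
        ‖Complex.exp (-2 * Real.pi * Complex.I * bidot t z)‖)
      ≤ Real.exp (k * ‖t‖) * Real.exp (k * ‖inner ℝ u t - x‖) *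
        (K1.rho (RSpace n) (k + 7 * n * k + N) φ * Real.exp (-((k + 7 * n * k + N : ℕ) * ‖t‖)) *
          ‖h (inner ℝ u t - x)‖ * Real.exp ((7 * n * k : ℕ) * ‖t‖)) := by
        gcongr
        exact norm_exp_bidot_le t hz
    _ = Real.exp (k * ‖inner ℝ u t - x‖) * ‖h (inner ℝ u t - x)‖ *
        (K1.rho (RSpace n) (k + 7 * n * k + N) φ * (Real.exp (k * ‖t‖) *
          Real.exp (-((k + 7 * n * k + N : ℕ) * ‖t‖)) * Real.exp ((7 * n * k : ℕ) * ‖t‖))) := by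
        ring
    _ ≤ K1.rho ℝ k h * (K1.rho (RSpace n) (k + 7 * n * k + N) φ * (Real.exp (k * ‖t‖) *
          Real.exp (-((k + 7 * n * k + N : ℕ) * ‖t‖)) * Real.exp ((7 * n * k : ℕ) * ‖t‖))) := by
        gcongr
    _ = _ := by
        rw [← Real.exp_add, ← Real.exp_add, ← mul_assoc]
        congr 2
        push_cast
        ring

theorem norm_dstftIntegrand_le (h : K1 ℝ) {u : RSpace n} (hu : ‖u‖ = 1)
    (φ : K1 (RSpace n)) (x : ℝ) {z : CSpace n} {k : ℕ} (hz : z ∈ tube n k) (N : ℕ)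
    (t : RSpace n) : ‖dstftIntegrand (fun s => conj (h s)) u φ x z t‖ ≤
      K1.rho ℝ k h * K1.rho (RSpace n) (k + 7 * n * k + N) φ * Real.exp (-(N * ‖t‖)) :=
  (le_mul_of_one_le_left (norm_nonneg _) (Real.one_le_exp (by positivity))).trans
    (exp_mul_norm_dstftIntegrand_le h hu φ x hz N t)

theorem integrable_exp_neg_mul_norm_RSpace {N : ℕ} (hN : n < N) :
    Integrable fun t : RSpace n => Real.exp (-(N * ‖t‖)) :=
  integrable_exp_neg_mul_norm volume (by simpa using hN)

theorem differentiable_bidot_left (z : CSpace n) :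
    Differentiable ℝ fun t : RSpace n => bidot t z := by
  have : (fun t : RSpace n => bidot t z) = fun t => ∑ j, coordCLM j t * z j := rfl
  rw [this]
  fun_prop

theorem continuous_dstftIntegrand (h : K1 ℝ) (u : RSpace n) (φ : K1 (RSpace n)) (x : ℝ)
    (z : CSpace n) : Continuous (dstftIntegrand (fun s => conj (h s)) u φ x z) := by
  rw [show dstftIntegrand (fun s => conj (h s)) u φ x z = _ from
    funext (dstftIntegrand_conj h u φ x z)]
  have h1 := h.continuous
  have h2 := φ.continuous
  have h3 := (differentiable_bidot_left z).continuous
  fun_prop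

theorem integrable_dstftIntegrand (h : K1 ℝ) {u : RSpace n} (hu : ‖u‖ = 1)
    (φ : K1 (RSpace n)) (x : ℝ) (z : CSpace n) :
    Integrable (dstftIntegrand (fun s => conj (h s)) u φ x z) := by
  obtain ⟨k, hk⟩ := exists_nat_ge ‖z‖
  exact ((integrable_exp_neg_mul_norm_RSpace (n := n) n.lt_succ_self).const_mul _).mono'
    (continuous_dstftIntegrand h u φ x z).aestronglyMeasurable
    (Filter.Eventually.of_forall fun t =>
      norm_dstftIntegrand_le h hu φ x (mem_tube_of_norm_le hk) (n + 1) t)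

/-- Exponential decrease in `x`, uniformly for `z` in a tube. -/
theorem exp_mul_norm_dstft_le (h : K1 ℝ) {u : RSpace n} (hu : ‖u‖ = 1)
    (φ : K1 (RSpace n)) (x : ℝ) {z : CSpace n} {k : ℕ} (hz : z ∈ tube n k) :
    Real.exp (k * |x|) * ‖dstft (fun s => conj (h s)) u φ x z‖ ≤
      (K1.rho ℝ k h * ∫ t : RSpace n, Real.exp (-((n + 1 : ℕ) * ‖t‖))) *
        K1.rho (RSpace n) (k + 7 * n * k + (n + 1)) φ := by
  have h1 : ‖(Real.exp (k * |x|) : ℂ) * dstft (fun s => conj (h s)) u φ x z‖ ≤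
      ∫ t : RSpace n, K1.rho ℝ k h * K1.rho (RSpace n) (k + 7 * n * k + (n + 1)) φ *
        Real.exp (-((n + 1 : ℕ) * ‖t‖)) := by
    rw [dstft, ← integral_const_mul]
    refine norm_integral_le_of_norm_le
      ((integrable_exp_neg_mul_norm_RSpace (n := n) n.lt_succ_self).const_mul _)
      (Filter.Eventually.of_forall fun t => ?_)
    rw [norm_mul, Complex.norm_real, Real.norm_of_nonneg (Real.exp_pos _).le]
    exact exp_mul_norm_dstftIntegrand_le h hu φ x hz (n + 1) t
  rw [norm_mul, Complex.norm_real, Real.norm_of_nonneg (Real.exp_pos _).le,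
    integral_const_mul] at h1
  exact h1.trans (le_of_eq (by ring))

theorem hasDerivAt_dstft (h : K1 ℝ) {u : RSpace n} (hu : ‖u‖ = 1)
    (φ : K1 (RSpace n)) (x : ℝ) (z : CSpace n) :
    HasDerivAt (fun x => dstft (fun s => conj (h s)) u φ x z)
      (-dstft (fun s => conj (K1.deriv h s)) u φ x z) x := by
  obtain ⟨k, hk⟩ := exists_nat_ge ‖z‖
  rw [dstft, ← integral_neg]
  refine (hasDerivAt_integral_of_dominated_loc_of_deriv_le (s := Set.univ)
    (bound := fun t => K1.rho ℝ k (K1.deriv h) *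
      K1.rho (RSpace n) (k + 7 * n * k + (n + 1)) φ * Real.exp (-((n + 1 : ℕ) * ‖t‖)))
    (F' := fun x t => -dstftIntegrand (fun s => conj (K1.deriv h s)) u φ x z t) Filter.univ_mem
    (Filter.Eventually.of_forall fun x =>
      (continuous_dstftIntegrand h u φ x z).aestronglyMeasurable)
    (integrable_dstftIntegrand h hu φ x z)
    (continuous_dstftIntegrand (K1.deriv h) u φ x z).neg.aestronglyMeasurable
    (Filter.Eventually.of_forall fun t x _ => ?_)
    ((integrable_exp_neg_mul_norm_RSpace (n := n) n.lt_succ_self).const_mul _)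
    (Filter.Eventually.of_forall fun t x _ => ?_)).2
  · rw [norm_neg]
    exact norm_dstftIntegrand_le (K1.deriv h) hu φ x (mem_tube_of_norm_le hk) (n + 1) t
  · simp only [dstftIntegrand_conj]
    have h1 : HasDerivAt (fun x => h (inner ℝ u t - x)) (-K1.deriv h (inner ℝ u t - x)) x := by
      have := HasDerivAt.scomp x (h.hasDerivAt (inner ℝ u t - x))
        ((hasDerivAt_id x).const_sub (inner ℝ u t))
      rwa [neg_smul, one_smul] at this
    refine ((h1.const_mul (φ t)).mul_const _).congr_deriv ?_
    ring

theorem contDiff_dstft (h : K1 ℝ) {u : RSpace n} (hu : ‖u‖ = 1)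
    (φ : K1 (RSpace n)) (z : CSpace n) :
    ContDiff ℝ ∞ fun x => dstft (fun s => conj (h s)) u φ x z := by
  refine contDiff_infty.2 fun m => ?_
  induction m generalizing h with
  | zero =>
    exact contDiff_zero.2 (continuous_iff_continuousAt.2 fun x =>
      (hasDerivAt_dstft h hu φ x z).continuousAt)
  | succ m ih =>
    refine (contDiff_succ_iff_deriv (n := m)).2
      ⟨fun x => (hasDerivAt_dstft h hu φ x z).differentiableAt, by simp, ?_⟩
    rw [show deriv _ = _ from funext fun x => (hasDerivAt_dstft h hu φ x z).deriv]
    exact (ih (K1.deriv h)).neg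

theorem iteratedDeriv_dstft (h : K1 ℝ) {u : RSpace n} (hu : ‖u‖ = 1)
    (φ : K1 (RSpace n)) (z : CSpace n) (l : ℕ) (x : ℝ) :
    iteratedDeriv l (fun x => dstft (fun s => conj (h s)) u φ x z) x =
      (-1) ^ l * dstft (fun s => conj ((K1.deriv^[l] h : K1 ℝ) s)) u φ x z := by
  induction l generalizing h with
  | zero => simp
  | succ l ih =>
    rw [iteratedDeriv_succ', show deriv _ = _ from
      funext fun x => (hasDerivAt_dstft h hu φ x z).deriv, iteratedDeriv_fun_neg, ih,
      Function.iterate_succ_apply, pow_succ]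
    ring

/-- The linear form `z ↦ t · z`. -/
def bidotCLM (t : RSpace n) : CSpace n →L[ℂ] ℂ := ∑ j, (t j : ℂ) • EuclideanSpace.proj j

theorem bidotCLM_apply (t : RSpace n) (z : CSpace n) : bidotCLM t z = bidot t z := by
  simp [bidotCLM, bidot]

theorem norm_bidotCLM_le (t : RSpace n) : ‖bidotCLM t‖ ≤ n * ‖t‖ := by
  refine ContinuousLinearMap.opNorm_le_bound _ (by positivity) fun z => ?_
  rw [bidotCLM_apply, bidot]
  refine (norm_sum_le _ _).trans ?_
  calc ∑ j, ‖(t j : ℂ) * z j‖ ≤ ∑ _j : Fin n, ‖t‖ * ‖z‖ := Finset.sum_le_sum fun j _ => by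
        rw [norm_mul, Complex.norm_real]
        exact mul_le_mul (abs_coord_le t j) (KUFun.norm_coord_le z j) (norm_nonneg _)
          (norm_nonneg _)
    _ = _ := by simp; ring

theorem continuous_bidotCLM : Continuous (bidotCLM : RSpace n → CSpace n →L[ℂ] ℂ) := by
  unfold bidotCLM
  refine continuous_finsetSum _ fun j _ => ?_
  exact (coordCLM j).continuous.smul continuous_const

theorem differentiable_dstft (h : K1 ℝ) {u : RSpace n} (hu : ‖u‖ = 1)
    (φ : K1 (RSpace n)) (x : ℝ) :
    Differentiable ℂ (dstft (fun s => conj (h s)) u φ x) := by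
  intro z₀
  -- the unit ball around `z₀` lies in the tube `Π_k`; one more power of `e^{-|t|}` than needed for
  -- integrability compensates the factor `|t|` in the derivative
  obtain ⟨k, hk⟩ := exists_nat_ge (‖z₀‖ + 1)
  set C := K1.rho ℝ k h * K1.rho (RSpace n) (k + 7 * n * k + (n + 2)) φ with hC
  set c : ℂ := -2 * Real.pi * Complex.I with hc
  have hC0 : 0 ≤ C := by positivity
  refine (hasFDerivAt_integral_of_dominated_of_fderiv_le (𝕜 := ℂ)
    (F := fun z t => dstftIntegrand (fun s => conj (h s)) u φ x z t)
    (F' := fun z t => (dstftIntegrand (fun s => conj (h s)) u φ x z t * c) • bidotCLM t)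
    (bound := fun t => C * ‖c‖ * n * Real.exp (-((n + 1 : ℕ) * ‖t‖)))
    (Metric.ball_mem_nhds z₀ one_pos)
    (Filter.Eventually.of_forall fun z =>
      (continuous_dstftIntegrand h u φ x z).aestronglyMeasurable)
    (integrable_dstftIntegrand h hu φ x z₀)
    (((continuous_dstftIntegrand h u φ x z₀).mul continuous_const).smul
      continuous_bidotCLM).aestronglyMeasurable
    (Filter.Eventually.of_forall fun t z hz => ?_)
    ((integrable_exp_neg_mul_norm_RSpace (n := n) n.lt_succ_self).const_mul _)
    (Filter.Eventually.of_forall fun t z _ => ?_)).differentiableAt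
  · have hzk : ‖z‖ ≤ k := by
      rw [Metric.mem_ball, dist_eq_norm] at hz
      have := norm_le_norm_add_norm_sub' z z₀
      linarith
    have h1 := norm_dstftIntegrand_le h hu φ x (mem_tube_of_norm_le hzk) (n + 2) t
    have h2 : ‖t‖ ≤ Real.exp ‖t‖ := by linarith [Real.add_one_le_exp ‖t‖]
    rw [norm_smul, norm_mul]
    calc _ ≤ C * Real.exp (-((n + 2 : ℕ) * ‖t‖)) * ‖c‖ * (n * Real.exp ‖t‖) := by
          gcongr
          exact (norm_bidotCLM_le t).trans (by gcongr)
      _ = C * ‖c‖ * n * (Real.exp (-((n + 2 : ℕ) * ‖t‖)) * Real.exp ‖t‖) := by ring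
      _ = _ := by
          rw [← Real.exp_add]
          congr 2
          push_cast
          ring
  · have h1 : HasFDerivAt (fun z : CSpace n => bidot t z) (bidotCLM t) z := by
      have := (bidotCLM t).hasFDerivAt (x := z)
      rwa [show ⇑(bidotCLM t) = fun z => bidot t z from funext (bidotCLM_apply t)] at this
    simp only [dstftIntegrand_conj]
    refine (((h1.const_mul c).cexp).const_mul (φ t * h (inner ℝ u t - x))).congr_fderiv ?_
    rw [smul_smul, smul_smul]

/-- Integration by parts: multiplication by `z_j` corresponds to differentiation of `φ` and `h`. -/
theorem coord_mul_dstft (h : K1 ℝ) {u : RSpace n} (hu : ‖u‖ = 1)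
    (φ : K1 (RSpace n)) (x : ℝ) (z : CSpace n) (j : Fin n) :
    2 * Real.pi * Complex.I * z j * dstft (fun s => conj (h s)) u φ x z =
      dstft (fun s => conj (h s)) u (K1.lineDeriv (EuclideanSpace.single j 1) φ) x z +
        u j * dstft (fun s => conj (K1.deriv h s)) u φ x z := by
  set v : RSpace n := EuclideanSpace.single j 1 with hv
  set e : RSpace n → ℂ := fun t => Complex.exp (-2 * Real.pi * Complex.I * bidot t z) with he
  set a : RSpace n → ℂ := fun t => φ t * h (inner ℝ u t - x) with ha
  have hed : ∀ t, HasFDerivAt e (e t • ((-2 * Real.pi * Complex.I) •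
      ∑ i, (z i) • coordCLM i)) t := fun t => by
    have h1 : HasFDerivAt (fun t : RSpace n => bidot t z) (∑ i, (z i) • coordCLM i) t := by
      have := (∑ i, (z i) • coordCLM i : RSpace n →L[ℝ] ℂ).hasFDerivAt (x := t)
      refine this.congr_of_eventuallyEq (Filter.Eventually.of_forall fun t => ?_)
      simp [bidot, mul_comm]
    exact (h1.const_mul _).cexp
  have had : ∀ t, HasFDerivAt a (φ t • (innerSL ℝ u).smulRight (K1.deriv h (inner ℝ u t - x)) +
      h (inner ℝ u t - x) • fderiv ℝ φ t) t := fun t => by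
    have h1 : HasFDerivAt (fun t : RSpace n => h (inner ℝ u t - x))
        ((innerSL ℝ u).smulRight (K1.deriv h (inner ℝ u t - x))) t := by
      have := (h.hasDerivAt (inner ℝ u t - x)).hasFDerivAt.comp t
        (((innerSL ℝ u).hasFDerivAt (x := t)).sub_const x)
      exact this
    exact (φ.differentiable t).hasFDerivAt.mul h1
  have hev : ∀ t, fderiv ℝ e t v = -2 * Real.pi * Complex.I * z j * e t := fun t => by
    rw [(hed t).fderiv]
    simp only [_root_.smul_apply, _root_.sum_apply, coordCLM_apply, hv, smul_eq_mul]
    rw [Finset.sum_eq_single j (fun i _ hi => by simp [hi]) (by simp)]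
    simp
    ring
  have hav : ∀ t, fderiv ℝ a t v = φ t * (u j * K1.deriv h (inner ℝ u t - x)) +
      h (inner ℝ u t - x) * K1.lineDeriv v φ t := fun t => by
    rw [(had t).fderiv]
    simp [K1.lineDeriv_apply, hv, EuclideanSpace.inner_single_right]
  have hI1 : (fun t => fderiv ℝ a t v * e t) = fun t =>
      u j * dstftIntegrand (fun s => conj (K1.deriv h s)) u φ x z t +
        dstftIntegrand (fun s => conj (h s)) u (K1.lineDeriv v φ) x z t := funext fun t => by
    rw [hav, dstftIntegrand_conj, dstftIntegrand_conj]
    ring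
  have hI2 : (fun t => a t * fderiv ℝ e t v) = fun t =>
      -2 * Real.pi * Complex.I * z j * dstftIntegrand (fun s => conj (h s)) u φ x z t :=
    funext fun t => by
      rw [hev, dstftIntegrand_conj]
      ring
  have hint1 : Integrable fun t => u j *
      dstftIntegrand (fun s => conj (K1.deriv h s)) u φ x z t :=
    (integrable_dstftIntegrand (K1.deriv h) hu φ x z).const_mul _
  have hint2 := integrable_dstftIntegrand h hu (K1.lineDeriv v φ) x z
  have hint3 := integrable_dstftIntegrand h hu φ x z
  have hparts := integral_mul_fderiv_eq_neg_fderiv_mul_of_integrable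
    (μ := (volume : Measure (RSpace n))) (f := a) (g := e) (v := v)
    (by rw [hI1]; exact hint1.add hint2) (by rw [hI2]; exact hint3.const_mul _)
    (by
      refine hint3.congr (Filter.Eventually.of_forall fun t => ?_)
      exact dstftIntegrand_conj h u φ x z t)
    (fun t _ => (had t).differentiableAt) (fun t _ => (hed t).differentiableAt)
  rw [hI1, hI2, integral_const_mul, integral_add hint1 hint2, integral_const_mul] at hparts
  simp only [dstft]
  linear_combination -hparts

theorem norm_coord_mul_dstft_le (h : K1 ℝ) {u : RSpace n} (hu : ‖u‖ = 1)
    (φ : K1 (RSpace n)) (x : ℝ) (z : CSpace n) (j : Fin n) :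
    ‖z j‖ * ‖dstft (fun s => conj (h s)) u φ x z‖ ≤
      ‖dstft (fun s => conj (h s)) u (K1.lineDeriv (EuclideanSpace.single j 1) φ) x z‖ +
        ‖(u j : ℂ)‖ * ‖dstft (fun s => conj (K1.deriv h s)) u φ x z‖ := by
  have h1 := congrArg norm (coord_mul_dstft h hu φ x z j)
  rw [norm_mul, norm_mul] at h1
  have h2 : ‖2 * Real.pi * Complex.I‖ = 2 * Real.pi := by
    simp [abs_of_pos Real.pi_pos]
  rw [h2] at h1
  have h3 := norm_add_le
    (dstft (fun s => conj (h s)) u (K1.lineDeriv (EuclideanSpace.single j 1) φ) x z)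
    (u j * dstft (fun s => conj (K1.deriv h s)) u φ x z)
  rw [← h1, norm_mul (u j : ℂ)] at h3
  have h4 : 0 ≤ ‖z j‖ * ‖dstft (fun s => conj (h s)) u φ x z‖ := by positivity
  nlinarith [Real.pi_gt_three]

/-- Rapid decrease in `z`, by induction on the power of `1 + |z| ≤ 1 + ∑ |z_j|`: each factor `z_j`
is traded for a derivative of `φ` or of `h`. -/
theorem exp_mul_pow_mul_norm_dstft_le (h : K1 ℝ) {u : RSpace n} (hu : ‖u‖ = 1) (k m : ℕ) :
    ∃ p : Seminorm ℂ (K1 (RSpace n)), Continuous p ∧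
      ∀ (φ : K1 (RSpace n)) (x : ℝ), ∀ z ∈ tube n k, Real.exp (k * |x|) * (1 + ‖z‖) ^ m *
        ‖dstft (fun s => conj (h s)) u φ x z‖ ≤ p φ := by
  induction m generalizing h with
  | zero =>
    let C : NNReal := ⟨K1.rho ℝ k h * ∫ t : RSpace n, Real.exp (-((n + 1 : ℕ) * ‖t‖)), by
      positivity⟩
    refine ⟨C • K1.rho (RSpace n) (k + 7 * n * k + (n + 1)),
      ((K1.withSeminorms _).continuous_seminorm _).const_smul C, fun φ x z hz => ?_⟩
    rw [pow_zero, mul_one]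
    exact exp_mul_norm_dstft_le h hu φ x hz
  | succ m ih =>
    obtain ⟨p, hpc, hp⟩ := ih h
    obtain ⟨q, hqc, hq⟩ := ih (K1.deriv h)
    let a : Fin n → NNReal := fun j => ‖(u j : ℂ)‖₊
    let D : Fin n → K1 (RSpace n) →L[ℂ] K1 (RSpace n) := fun j =>
      K1.lineDeriv (EuclideanSpace.single j 1)
    let P : Fin n → Seminorm ℂ (K1 (RSpace n)) := fun j =>
      p.comp (D j).toLinearMap + a j • q
    have hsum : ⇑(∑ j, P j) = fun φ => ∑ j, P j φ := funext fun φ => by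
      rw [← FunLike.coeAddMonoidHom_apply, map_sum, Finset.sum_apply]
      rfl
    have hPc : Continuous ⇑(∑ j, P j) := by
      rw [hsum]
      exact continuous_finsetSum _ fun j _ =>
        (hpc.comp (D j).continuous).add (hqc.const_smul (a j))
    refine ⟨p + ∑ j, P j, hpc.add hPc, fun φ x z hz => ?_⟩
    rw [_root_.add_apply, hsum]
    have hz1 : ‖z‖ ≤ ∑ j, ‖z j‖ := by
      rw [EuclideanSpace.norm_eq]
      exact Real.sqrt_le_iff.2 ⟨by positivity,
        Finset.sum_sq_le_sq_sum_of_nonneg fun j _ => norm_nonneg _⟩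
    set E := Real.exp (k * |x|) * (1 + ‖z‖) ^ m with hE
    set d := ‖dstft (fun s => conj (h s)) u φ x z‖ with hd
    calc Real.exp (k * |x|) * (1 + ‖z‖) ^ (m + 1) * d = E * d + E * (‖z‖ * d) := by
          rw [hE]; ring
      _ ≤ E * d + E * ((∑ j, ‖z j‖) * d) := by gcongr
      _ = E * d + ∑ j, E * (‖z j‖ * d) := by rw [Finset.sum_mul, Finset.mul_sum]
      _ ≤ p φ + ∑ j, P j φ := by
          refine add_le_add (hp φ x z hz) (Finset.sum_le_sum fun j _ => ?_)
          calc E * (‖z j‖ * d) ≤ E * _ :=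
                mul_le_mul_of_nonneg_left (norm_coord_mul_dstft_le h hu φ x z j) (by positivity)
            _ = E * ‖dstft (fun s => conj (h s)) u (D j φ) x z‖ + ‖(u j : ℂ)‖ *
                (E * ‖dstft (fun s => conj (K1.deriv h s)) u φ x z‖) := by ring
            _ ≤ p (D j φ) + ‖(u j : ℂ)‖ * q φ :=
                add_le_add (hp _ x z hz)
                  (mul_le_mul_of_nonneg_left (hq φ x z hz) (norm_nonneg _))

/-- The transform `DS_{h̄,u}` as a continuous linear map from `𝒦₁(ℝⁿ)`. -/
def dstftCLM (h : K1 ℝ) (u : RSpace n) (hu : ‖u‖ = 1) : K1 (RSpace n) →L[ℂ] KUFun n :=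
  KUFun.mkCLM
    { toFun := fun φ x z => dstft (fun s => conj (h s)) u φ x z
      map_add' := fun φ ψ => funext fun x => funext fun z => by
        simp only [Pi.add_apply, dstft]
        rw [← integral_add (integrable_dstftIntegrand h hu φ x z)
          (integrable_dstftIntegrand h hu ψ x z)]
        congr 1 with t
        simp only [dstftIntegrand_conj, ← add_mul]
        rfl
      map_smul' := fun c φ => funext fun x => funext fun z => by
        simp only [Pi.smul_apply, dstft, RingHom.id_apply]
        rw [← integral_smul]
        congr 1 with t
        simp only [dstftIntegrand_conj, smul_eq_mul, ← mul_assoc]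
        rfl }
    (fun φ z => contDiff_dstft h hu φ z) (fun φ x => differentiable_dstft h hu φ x)
    (fun k l => by
      obtain ⟨p, hpc, hp⟩ := exp_mul_pow_mul_norm_dstft_le (K1.deriv^[l] h) hu k k
      refine ⟨p, hpc, fun φ x z hz => le_trans ?_ (hp φ x z hz)⟩
      have h1 := congrArg norm (iteratedDeriv_dstft h hu φ z l x)
      rw [norm_mul, norm_pow, norm_neg, norm_one, one_pow, one_mul] at h1
      refine mul_le_mul (mul_le_mul_of_nonneg_left (KUFun.rpow_weight_le k (norm_nonneg z))
        (Real.exp_pos _).le) h1.le (norm_nonneg _) (by positivity))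

end Analysis

end

theorem mainTheorem7 {n : ℕ} (g : K1 ℝ) (u : RSpace n) (hu : ‖u‖ = 1) :
    -- the DSTFT of distributions, `⟨DS_{g,u} f, Φ⟩ = ⟨f, DS*_{ḡ,u} Φ⟩`
    (∃ S : KTensorU n → K1 (RSpace n),
      (∀ (Φ : KTensorU n) (t : RSpace n),
        Integrable (fun p : ℝ × RSpace n =>
          synthIntegrand (fun s => conj (g s)) u (Φ : KUFun n) t p.1 p.2) ∧
        S Φ t = synth (fun s => conj (g s)) u (Φ : KUFun n) t) ∧
      ∃ DS : K1Dual n →L[ℂ] KTensorUDual n,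
        ∀ (f : K1Dual n) (Φ : KTensorU n), DS f Φ = f (S Φ)) ∧
    -- the synthesis operator on distributions, `⟨DS*_{g,u} F, φ⟩ = ⟨F, DS_{ḡ,u} φ⟩`
    (∃ V : K1 (RSpace n) → KTensorU n,
      (∀ (φ : K1 (RSpace n)) (x : ℝ) (z : CSpace n),
        Integrable (dstftIntegrand (fun s => conj (g s)) u φ x z) ∧
        (V φ : KUFun n) x z = dstft (fun s => conj (g s)) u φ x z) ∧
      ∃ DSstar : KTensorUDual n →L[ℂ] K1Dual n,
        ∀ (F : KTensorUDual n) (φ : K1 (RSpace n)), DSstar F φ = F (V φ)) := by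
  let S : KTensorU n →L[ℂ] K1 (RSpace n) := (synthCLM g.conjugate u).comp (KTensorU n).subtypeL
  let V : K1 (RSpace n) →L[ℂ] KTensorU n := (dstftCLM g u hu).codRestrict (KTensorU n) fun φ => by
    rw [kTensorU_eq_top]
    exact Submodule.mem_top
  exact ⟨⟨S, fun Φ t => ⟨integrable_synthIntegrand g.conjugate u Φ t, rfl⟩,
      ContinuousLinearMap.precomp ℂ S, fun _ _ => rfl⟩,
    ⟨V, fun φ x z => ⟨integrable_dstftIntegrand g hu φ x z, rfl⟩,
      ContinuousLinearMap.precomp ℂ V, fun _ _ => rfl⟩⟩
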